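/- Let $(\widetilde M, g, J)$ be a complex space form $\widetilde M(\mu)$ of real dimension $2m$, that is, a Kähler manifold ($g$ a Riemannian metric, $J$ a $g$-orthogonal almost complex structure with $\widetilde\nabla J=0$ for the Levi-Civita connection $\widetilde\nabla$ of $g$) of constant holomorphic sectional curvature $\mu$. Let $M$ be a non-empty $n$-dimensional ($n>1$) submanifold of $\widetilde M$ (isometrically immersed, with the induced metric) with Levi-Civita connection $\nabla$ and curvature tensor $R$, second fundamental form $\sigma(X,Y)=\widetilde\nabla_XY-\nabla_XY$, and normal connection $D_X\xi=(\widetilde\nabla_X\xi)^{\perp}$ with curvature tensor $R^\perp$. Assume that 1. $M$ is totally real: $J(T_pM)\subset T_pM^{\perp}$ for all $p\in M$; 2. $M$ is semiparallel: $R^\perp(X,Y)\sigma(Z,U)-\sigma(R(X,Y)Z,U)-\sigma(Z,R(X,Y)U)=0$ for all tangent vector fields $X,Y,Z,U$ on $M$; 3. $M$ is of constant sectional curvature $c$; 4. the $f$-structure in the normal bundle is parallel: if $f\xi$ denotes the normal component of $J\xi$ for a normal vector field $\xi$, then $D_X(f\xi)=f(D_X\xi)$ for all tangent $X$ and normal $\xi$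 (the case $f=0$ is allowed). Then either $c=0$ and $M$ is flat ($R=0$), or $M$ is totally geodesic ($\sigma=0$) and $c=\mu/4$. -/

import Mathlib

open Bundle FiberBundle VectorField Module
open scoped Manifold ContDiff Topology

noncomputable section

namespace TotallyReal

/-! ### The Levi-Civita connection of a Riemannian manifold -/

section RiemannianBundles

variable {EB : Type*} [NormedAddCommGroup EB] [NormedSpace ℝ EB]
  {HB : Type*} [TopologicalSpace HB] {IB : ModelWithCorners ℝ EB HB}
  {B : Type*} [TopologicalSpace B] [ChartedSpace HB B]
  {F : Type*} [NormedAddCommGroup F] [NormedSpace ℝ F] {V : B → Type*}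
  [TopologicalSpace (TotalSpace F V)] [∀ b, TopologicalSpace (V b)]
  [∀ b, AddCommGroup (V b)] [∀ b, Module ℝ (V b)]
  [∀ b, IsTopologicalAddGroup (V b)] [∀ b, ContinuousConstSMul ℝ (V b)]
  [FiberBundle F V] [VectorBundle ℝ F V] [RiemannianBundle V]
  [IsContMDiffRiemannianBundle IB 1 F V]

theorem mdifferentiableAt_inner_bundle {x : B} {X Y : Π x, V x}
    (hX : MDiffAt (T% X) x) (hY : MDiffAt (T% Y) x) :
    MDiffAt (fun q ↦ inner ℝ (X q) (Y q)) x :=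
  hX.inner_bundle hY

end RiemannianBundles

section LeviCivita

variable {E : Type*} [NormedAddCommGroup E] [NormedSpace ℝ E]
  {M : Type*} [TopologicalSpace M] [ChartedSpace E M]

instance tangentSpace_finiteDimensional [FiniteDimensional ℝ E] (x : M) :
    FiniteDimensional ℝ (TangentSpace 𝓘(ℝ, E) x) :=
  inferInstanceAs (FiniteDimensional ℝ E)

variable [IsManifold 𝓘(ℝ, E) ∞ M]
  [RiemannianBundle (fun x : M ↦ TangentSpace 𝓘(ℝ, E) x)]

instance tangentSpace_completeSpace [FiniteDimensional ℝ E] (x : M) :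
    CompleteSpace (TangentSpace 𝓘(ℝ, E) x) :=
  FiniteDimensional.complete ℝ _

/-- The right-hand side of the Koszul formula for `⟨∇_X Y, Z⟩` at the point `x`. -/
def koszul (Y X Z : Π x : M, TangentSpace 𝓘(ℝ, E) x) (x : M) : ℝ :=
  (1 / 2) * (d% (fun q ↦ inner ℝ (Y q) (Z q)) x (X x)
    + d% (fun q ↦ inner ℝ (X q) (Z q)) x (Y x)
    - d% (fun q ↦ inner ℝ (X q) (Y q)) x (Z x)
    + inner ℝ (mlieBracket 𝓘(ℝ, E) X Y x) (Z x)
    - inner ℝ (mlieBracket 𝓘(ℝ, E) X Z x) (Y x)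
    - inner ℝ (mlieBracket 𝓘(ℝ, E) Y Z x) (X x))

variable [IsContMDiffRiemannianBundle 𝓘(ℝ, E) ∞ E (fun x : M ↦ TangentSpace 𝓘(ℝ, E) x)]
  {x : M} {X Y Z : Π x : M, TangentSpace 𝓘(ℝ, E) x}

theorem mdifferentiableAt_inner (hX : MDiffAt (T% X) x) (hY : MDiffAt (T% Y) x) :
    MDiffAt (fun q ↦ inner ℝ (X q) (Y q)) x :=
  mdifferentiableAt_inner_bundle hX hY

variable [FiniteDimensional ℝ E]

theorem tensorialAt_koszul_left (hY : MDiffAt (T% Y) x) (hZ : MDiffAt (T% Z) x) :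
    TensorialAt 𝓘(ℝ, E) E (fun X ↦ koszul Y X Z x) x where
  smul {f X} hf hX := by
    have h1 := mvfderiv_fun_mul hf (mdifferentiableAt_inner hX hZ)
    have h2 := mvfderiv_fun_mul hf (mdifferentiableAt_inner hX hY)
    simp [koszul, inner_smul_left, inner_smul_right, inner_add_left, h1, h2,
      mlieBracket_smul_left hf hX]
    ring
  add {X X'} hX hX' := by
    have h1 := mvfderiv_fun_add (mdifferentiableAt_inner hX hZ) (mdifferentiableAt_inner hX' hZ)
    have h2 := mvfderiv_fun_add (mdifferentiableAt_inner hX hY) (mdifferentiableAt_inner hX' hY)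
    simp [koszul, inner_add_left, inner_add_right, h1, h2, mlieBracket_add_left hX hX']
    ring

theorem tensorialAt_koszul_right (hY : MDiffAt (T% Y) x) (hX : MDiffAt (T% X) x) :
    TensorialAt 𝓘(ℝ, E) E (fun Z ↦ koszul Y X Z x) x where
  smul {f Z} hf hZ := by
    have h1 := mvfderiv_fun_mul hf (mdifferentiableAt_inner hY hZ)
    have h2 := mvfderiv_fun_mul hf (mdifferentiableAt_inner hX hZ)
    simp [koszul, inner_smul_left, inner_smul_right, inner_add_left, h1, h2,
      mlieBracket_smul_right hf hZ]
    rw [real_inner_comm (Y x) (Z x), real_inner_comm (X x) (Z x)]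
    ring
  add {Z Z'} hZ hZ' := by
    have h1 := mvfderiv_fun_add (mdifferentiableAt_inner hY hZ) (mdifferentiableAt_inner hY hZ')
    have h2 := mvfderiv_fun_add (mdifferentiableAt_inner hX hZ) (mdifferentiableAt_inner hX hZ')
    simp [koszul, inner_add_left, inner_add_right, h1, h2, mlieBracket_add_right hZ hZ']
    ring

theorem koszul_add {Y' : Π x : M, TangentSpace 𝓘(ℝ, E) x} (hX : MDiffAt (T% X) x)
    (hY : MDiffAt (T% Y) x) (hY' : MDiffAt (T% Y') x) (hZ : MDiffAt (T% Z) x) :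
    koszul (Y + Y') X Z x = koszul Y X Z x + koszul Y' X Z x := by
  have h1 := mvfderiv_fun_add (mdifferentiableAt_inner hY hZ) (mdifferentiableAt_inner hY' hZ)
  have h2 := mvfderiv_fun_add (mdifferentiableAt_inner hX hY) (mdifferentiableAt_inner hX hY')
  simp [koszul, inner_add_left, inner_add_right, h1, h2, mlieBracket_add_left hY hY',
    mlieBracket_add_right hY hY']
  ring

theorem koszul_smul {f : M → ℝ} (hf : MDiffAt f x) (hX : MDiffAt (T% X) x)
    (hY : MDiffAt (T% Y) x) (hZ : MDiffAt (T% Z) x) :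
    koszul (f • Y) X Z x = f x * koszul Y X Z x + d% f x (X x) * inner ℝ (Y x) (Z x) := by
  have h1 := mvfderiv_fun_mul hf (mdifferentiableAt_inner hY hZ)
  have h2 := mvfderiv_fun_mul hf (mdifferentiableAt_inner hX hY)
  simp [koszul, inner_add_left, inner_smul_left, inner_smul_right, h1, h2,
    mlieBracket_smul_left hf hY, mlieBracket_smul_right hf hY]
  rw [real_inner_comm (X x) (Y x)]
  ring

/-- The bilinear form `(u, w) ↦ ⟨∇_u Y, w⟩` on the tangent space at `x`. -/
def koszulForm (Y : Π x : M, TangentSpace 𝓘(ℝ, E) x) (x : M) (hY : MDiffAt (T% Y) x) :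
    TangentSpace 𝓘(ℝ, E) x →L[ℝ] TangentSpace 𝓘(ℝ, E) x →L[ℝ] ℝ :=
  TensorialAt.mkHom₂ (I := 𝓘(ℝ, E)) (F := E) (F' := E) (fun X Z ↦ koszul Y X Z x) x
    (fun _ hZ ↦ tensorialAt_koszul_left hY hZ) (fun _ hX ↦ tensorialAt_koszul_right hY hX)

open scoped Classical in
/-- `u ↦ ∇_u Y` at `x`, the vector dual to the Koszul form. The value at a point where the vector
field `Y` is not differentiable is irrelevant. -/
def leviCivitaFun (Y : Π x : M, TangentSpace 𝓘(ℝ, E) x) (x : M) :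
    TangentSpace 𝓘(ℝ, E) x →L[ℝ] TangentSpace 𝓘(ℝ, E) x :=
  if hY : MDiffAt (T% Y) x then
    LinearMap.toContinuousLinearMap
      { toFun v := (InnerProductSpace.toDual ℝ (TangentSpace 𝓘(ℝ, E) x)).symm (koszulForm Y x hY v)
        map_add' := by simp
        map_smul' := by simp }
  else 0

/-- The Koszul formula. -/
theorem inner_leviCivitaFun (hX : MDiffAt (T% X) x) (hY : MDiffAt (T% Y) x)
    (hZ : MDiffAt (T% Z) x) :
    inner ℝ (leviCivitaFun Y x (X x)) (Z x) = koszul Y X Z x := by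
  have h : koszulForm Y x hY (X x) (Z x) = koszul Y X Z x :=
    TensorialAt.mkHom₂_apply _ _ hX hZ
  simp [leviCivitaFun, hY, h]

theorem leviCivitaFun_isCovariantDerivativeOn :
    IsCovariantDerivativeOn (I := 𝓘(ℝ, E)) (V := fun x : M ↦ TangentSpace 𝓘(ℝ, E) x) E
      leviCivitaFun Set.univ where
  add {Y Y' x} hY hY' _ := by
    ext1 v
    refine ext_inner_right ℝ fun w ↦ ?_
    have hv := mdifferentiableAt_extend 𝓘(ℝ, E) E v
    have hw := mdifferentiableAt_extend 𝓘(ℝ, E) E w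
    have hs := mdifferentiableAt_add_section hY hY'
    have e1 := inner_leviCivitaFun hv hs hw
    have e2 := inner_leviCivitaFun hv hY hw
    have e3 := inner_leviCivitaFun hv hY' hw
    simp only [extend_apply_self] at e1 e2 e3
    rw [e1, koszul_add hv hY hY' hw, ← e2, ← e3, ← inner_add_left]
    rfl
  leibniz {Y g x} hY hg _ := by
    ext1 v
    refine ext_inner_right ℝ fun w ↦ ?_
    have hv := mdifferentiableAt_extend 𝓘(ℝ, E) E v
    have hw := mdifferentiableAt_extend 𝓘(ℝ, E) E w
    have hs := hg.smul_section hY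
    have e1 := inner_leviCivitaFun hv hs hw
    have e2 := inner_leviCivitaFun hv hY hw
    have e3 := koszul_smul hg hv hY hw
    simp only [extend_apply_self] at e1 e2 e3
    rw [e1, e3, ← e2, ← real_inner_smul_left, ← real_inner_smul_left, ← inner_add_left]
    rfl

/-- The Levi-Civita connection of the Riemannian manifold `M`, given by the Koszul formula.
`leviCivita Y x (X x)` is `∇_X Y` at the point `x`. -/
def leviCivita : CovariantDerivative 𝓘(ℝ, E) E (fun x : M ↦ TangentSpace 𝓘(ℝ, E) x) :=
  ⟨leviCivitaFun, leviCivitaFun_isCovariantDerivativeOn⟩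

/-- The Levi-Civita connection is torsion free. -/
theorem leviCivita_torsion (hX : MDiffAt (T% X) x) (hY : MDiffAt (T% Y) x) :
    leviCivita Y x (X x) - leviCivita X x (Y x) = mlieBracket 𝓘(ℝ, E) X Y x := by
  refine ext_inner_right ℝ fun w ↦ ?_
  have hw := mdifferentiableAt_extend 𝓘(ℝ, E) E w
  have e1 := inner_leviCivitaFun hX hY hw
  have e2 := inner_leviCivitaFun hY hX hw
  simp only [extend_apply_self] at e1 e2
  have h : (fun q ↦ inner ℝ (X q) (Y q)) = fun q ↦ inner ℝ (Y q) (X q) :=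
    funext fun q ↦ real_inner_comm _ _
  rw [inner_sub_left]
  change inner ℝ (leviCivitaFun Y x (X x)) w - inner ℝ (leviCivitaFun X x (Y x)) w = _
  rw [e1, e2, koszul, koszul, h, mlieBracket_swap_apply (V := Y) (W := X)]
  simp only [extend_apply_self, inner_neg_left]
  ring

/-- The Levi-Civita connection is compatible with the metric. -/
theorem leviCivita_metric (hX : MDiffAt (T% X) x) (hY : MDiffAt (T% Y) x)
    (hZ : MDiffAt (T% Z) x) :
    d% (fun q ↦ inner ℝ (Y q) (Z q)) x (X x) =
      inner ℝ (leviCivita Y x (X x)) (Z x) + inner ℝ (Y x) (leviCivita Z x (X x)) := by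
  have e1 := inner_leviCivitaFun hX hY hZ
  have e2 := inner_leviCivitaFun hX hZ hY
  have h : (fun q ↦ inner ℝ (Y q) (Z q)) = fun q ↦ inner ℝ (Z q) (Y q) :=
    funext fun q ↦ real_inner_comm _ _
  rw [real_inner_comm (leviCivita Z x (X x)) (Y x)]
  change _ = inner ℝ (leviCivitaFun Y x (X x)) (Z x) + inner ℝ (leviCivitaFun Z x (X x)) (Y x)
  rw [e1, e2, koszul, koszul, h, mlieBracket_swap_apply (V := Z) (W := Y)]
  simp only [inner_neg_left]
  ring

/-! ### Curvature

Vector fields are arbitrary families of tangent vectors; a condition on the value at `p` of an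
expression in vector fields is imposed for all fields that are `C^∞` at `p`. -/

/-- The curvature `R(X, Y)Z = ∇_X ∇_Y Z - ∇_Y ∇_X Z - ∇_[X,Y] Z` of the Levi-Civita connection. -/
def curvature (X Y Z : Π x : M, TangentSpace 𝓘(ℝ, E) x) (p : M) : TangentSpace 𝓘(ℝ, E) p :=
  leviCivita (fun q ↦ leviCivita Z q (Y q)) p (X p)
    - leviCivita (fun q ↦ leviCivita Z q (X q)) p (Y p)
    - leviCivita Z p (mlieBracket 𝓘(ℝ, E) X Y p)

/-- The sectional curvature of the plane spanned by `X p` and `Y p`. -/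
def sectionalCurvature (X Y : Π x : M, TangentSpace 𝓘(ℝ, E) x) (p : M) : ℝ :=
  inner ℝ (curvature X Y Y p) (X p) /
    (inner ℝ (X p) (X p) * inner ℝ (Y p) (Y p) - inner ℝ (X p) (Y p) ^ 2)

variable (E M) in
/-- The Riemannian manifold `M` is of constant (sectional) curvature `c`. -/
def HasConstantCurvature (c : ℝ) : Prop :=
  ∀ (p : M) (X Y : Π x : M, TangentSpace 𝓘(ℝ, E) x),
    CMDiffAt ∞ (T% X) p → CMDiffAt ∞ (T% Y) p → LinearIndependent ℝ ![X p, Y p] →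
      sectionalCurvature X Y p = c

variable (E M) in
/-- The Riemannian manifold `M` is flat: its curvature tensor vanishes. -/
def IsFlat : Prop :=
  ∀ (p : M) (X Y Z : Π x : M, TangentSpace 𝓘(ℝ, E) x),
    CMDiffAt ∞ (T% X) p → CMDiffAt ∞ (T% Y) p → CMDiffAt ∞ (T% Z) p → curvature X Y Z p = 0

/-! ### Kähler manifolds and complex space forms -/

/-- `J` is a Kähler structure on the Riemannian manifold `M`: a smooth field of orthogonal complex
structures on the tangent spaces with `(∇_X J) Y = ∇_X (J Y) - J (∇_X Y) = 0`. -/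
structure IsKaehler (J : Π x : M, TangentSpace 𝓘(ℝ, E) x →L[ℝ] TangentSpace 𝓘(ℝ, E) x) :
    Prop where
  smooth : ContMDiff 𝓘(ℝ, E) (𝓘(ℝ, E).prod 𝓘(ℝ, E →L[ℝ] E)) ∞
    (fun x ↦ TotalSpace.mk' (E →L[ℝ] E)
      (E := fun x : M ↦ TangentSpace 𝓘(ℝ, E) x →L[ℝ] TangentSpace 𝓘(ℝ, E) x) x (J x))
  sq : ∀ (x : M) (v : TangentSpace 𝓘(ℝ, E) x), J x (J x v) = -v
  isometry : ∀ (x : M) (v w : TangentSpace 𝓘(ℝ, E) x), inner ℝ (J x v) (J x w) = inner ℝ v w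
  parallel : ∀ (x : M) (v : TangentSpace 𝓘(ℝ, E) x) (Y : Π x : M, TangentSpace 𝓘(ℝ, E) x),
    CMDiffAt ∞ (T% Y) x → leviCivita (fun q ↦ J q (Y q)) x v = J x (leviCivita Y x v)

/-- `(M, J)` is a complex space form `M(μ)`: a Kähler manifold of constant holomorphic sectional
curvature `μ`. -/
structure IsComplexSpaceForm
    (J : Π x : M, TangentSpace 𝓘(ℝ, E) x →L[ℝ] TangentSpace 𝓘(ℝ, E) x) (μ : ℝ) : Prop where
  isKaehler : IsKaehler J
  holomorphic_curvature : ∀ (p : M) (X : Π x : M, TangentSpace 𝓘(ℝ, E) x),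
    CMDiffAt ∞ (T% X) p → X p ≠ 0 → sectionalCurvature X (fun q ↦ J q (X q)) p = μ

end LeviCivita

/-! ### Submanifolds

A submanifold of `N` is a smooth isometric immersion `F : M → N`; the tangent space `T_p M` is regarded
as the subspace `dF(T_p M)` of `T_{F p} N`. -/

section Submanifold

variable {E : Type*} [NormedAddCommGroup E] [NormedSpace ℝ E]
  {M : Type*} [TopologicalSpace M] [ChartedSpace E M]
  {E' : Type*} [NormedAddCommGroup E'] [NormedSpace ℝ E']
  {N : Type*} [TopologicalSpace N] [ChartedSpace E' N]

/-- The differential `dF : T_p M → T_{F p} N`. -/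
abbrev differential (F : C^∞⟮𝓘(ℝ, E), M; 𝓘(ℝ, E'), N⟯) (p : M) :
    TangentSpace 𝓘(ℝ, E) p →L[ℝ] TangentSpace 𝓘(ℝ, E') (F p) :=
  mfderiv 𝓘(ℝ, E) 𝓘(ℝ, E') F p

/-- The vector field `V` along `F` is of class `C^∞` at `p`. -/
def SmoothAlongAt [IsManifold 𝓘(ℝ, E') ∞ N] (F : C^∞⟮𝓘(ℝ, E), M; 𝓘(ℝ, E'), N⟯)
    (V : Π q : M, TangentSpace 𝓘(ℝ, E') (F q)) (p : M) : Prop :=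
  ContMDiffAt 𝓘(ℝ, E) (𝓘(ℝ, E').prod 𝓘(ℝ, E')) ∞
    (fun q ↦ TotalSpace.mk' E' (E := fun x : N ↦ TangentSpace 𝓘(ℝ, E') x) (F q) (V q)) p

variable [IsManifold 𝓘(ℝ, E') ∞ N] [RiemannianBundle (fun x : N ↦ TangentSpace 𝓘(ℝ, E') x)]

section Normal

variable [FiniteDimensional ℝ E']

/-- The normal space `T_p M^⊥` in `T_{F p} N`. -/
def normalSpace (F : C^∞⟮𝓘(ℝ, E), M; 𝓘(ℝ, E'), N⟯) (p : M) : Submodule ℝ (TangentSpace 𝓘(ℝ, E') (F p)) :=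
  (LinearMap.range (differential F p).toLinearMap)ᗮ

/-- The normal component of a tangent vector of `N` at `F p`. -/
def normalPart (F : C^∞⟮𝓘(ℝ, E), M; 𝓘(ℝ, E'), N⟯) (p : M) (v : TangentSpace 𝓘(ℝ, E') (F p)) :
    TangentSpace 𝓘(ℝ, E') (F p) :=
  (normalSpace F p).starProjection v

/-- The endomorphism `f` of the normal bundle: `f ξ` is the normal component of `J ξ`. -/
def normalF (J : Π x : N, TangentSpace 𝓘(ℝ, E') x →L[ℝ] TangentSpace 𝓘(ℝ, E') x) (F : C^∞⟮𝓘(ℝ, E), M; 𝓘(ℝ, E'), N⟯)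
    (p : M) (v : TangentSpace 𝓘(ℝ, E') (F p)) : TangentSpace 𝓘(ℝ, E') (F p) :=
  normalPart F p (J (F p) v)

end Normal

/-- `F` is a totally real submanifold: `J T_p M ⊆ T_p M^⊥` for all `p`. -/
def IsTotallyReal (J : Π x : N, TangentSpace 𝓘(ℝ, E') x →L[ℝ] TangentSpace 𝓘(ℝ, E') x)
    (F : C^∞⟮𝓘(ℝ, E), M; 𝓘(ℝ, E'), N⟯) : Prop :=
  ∀ (p : M) (v : TangentSpace 𝓘(ℝ, E) p), J (F p) (differential F p v) ∈ normalSpace F p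

variable [FiniteDimensional ℝ E']
  [IsContMDiffRiemannianBundle 𝓘(ℝ, E') ∞ E' (fun x : N ↦ TangentSpace 𝓘(ℝ, E') x)]

/-- The covariant derivative `u ↦ ∇~_u V` at `p` of a vector field `V` along `F`, for the
Levi-Civita connection `∇~` of `N`. In the chart of `N` at `F p`, if `V = ∑ a, V^a ∂_a`, then
`∇~_u V = ∑ a, u(V^a) ∂_a + ∑ a, V^a(p) ∇~_{dF u} ∂_a`; here `extend E' (V p)` is the vector field
`∑ a, V^a(p) ∂_a` near `F p`. -/
def covDerivAlong (F : C^∞⟮𝓘(ℝ, E), M; 𝓘(ℝ, E'), N⟯) (V : Π q : M, TangentSpace 𝓘(ℝ, E') (F q)) (p : M) :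
    TangentSpace 𝓘(ℝ, E) p →L[ℝ] TangentSpace 𝓘(ℝ, E') (F p) :=
  letI t := trivializationAt E' (fun x : N ↦ TangentSpace 𝓘(ℝ, E') x) (F p)
  (t.symmL ℝ (F p)).comp (d% (fun q ↦ (t ⟨F q, V q⟩).2) p)
    + (leviCivita (extend E' (V p)) (F p)).comp (differential F p)

/-- The connection of the normal bundle: `normalConn F ξ p (X p)` is `D_X ξ` at `p`, the normal
component of `∇~_X ξ`. -/
def normalConn (F : C^∞⟮𝓘(ℝ, E), M; 𝓘(ℝ, E'), N⟯) (ξ : Π q : M, TangentSpace 𝓘(ℝ, E') (F q)) (p : M)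
    (u : TangentSpace 𝓘(ℝ, E) p) : TangentSpace 𝓘(ℝ, E') (F p) :=
  normalPart F p (covDerivAlong F ξ p u)

/-- The `f`-structure in the normal bundle is parallel: `D_X (f ξ) = f (D_X ξ)` for all normal
vector fields `ξ`. -/
def HasParallelNormalF
    (J : Π x : N, TangentSpace 𝓘(ℝ, E') x →L[ℝ] TangentSpace 𝓘(ℝ, E') x) (F : C^∞⟮𝓘(ℝ, E), M; 𝓘(ℝ, E'), N⟯) : Prop :=
  ∀ (p : M) (u : TangentSpace 𝓘(ℝ, E) p) (ξ : Π q : M, TangentSpace 𝓘(ℝ, E') (F q)),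
    (∀ q, ξ q ∈ normalSpace F q) → SmoothAlongAt F ξ p →
      normalConn F (fun q ↦ normalF J F q (ξ q)) p u = normalF J F p (normalConn F ξ p u)

/-- The curvature of the normal connection,
`R^⊥(X, Y)ξ = D_X D_Y ξ - D_Y D_X ξ - D_[X,Y] ξ`. -/
def normalCurvature (F : C^∞⟮𝓘(ℝ, E), M; 𝓘(ℝ, E'), N⟯) (X Y : Π q : M, TangentSpace 𝓘(ℝ, E) q)
    (ξ : Π q : M, TangentSpace 𝓘(ℝ, E') (F q)) (p : M) : TangentSpace 𝓘(ℝ, E') (F p) :=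
  normalConn F (fun q ↦ normalConn F ξ q (Y q)) p (X p)
    - normalConn F (fun q ↦ normalConn F ξ q (X q)) p (Y p)
    - normalConn F ξ p (mlieBracket 𝓘(ℝ, E) X Y p)

variable [IsManifold 𝓘(ℝ, E) ∞ M]
  [RiemannianBundle (fun x : M ↦ TangentSpace 𝓘(ℝ, E) x)]

/-- `F` is an isometric immersion, i.e. the metric of `M` is the one induced by `F`. -/
def IsIsometricImmersion (F : C^∞⟮𝓘(ℝ, E), M; 𝓘(ℝ, E'), N⟯) : Prop :=
  ∀ (p : M) (u v : TangentSpace 𝓘(ℝ, E) p),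
    inner ℝ (differential F p u) (differential F p v) = inner ℝ u v

variable [IsContMDiffRiemannianBundle 𝓘(ℝ, E) ∞ E (fun x : M ↦ TangentSpace 𝓘(ℝ, E) x)]
  [FiniteDimensional ℝ E]

/-- The second fundamental form, given by the Gauss formula `∇~_X Y = ∇_X Y + σ(X, Y)`, where `∇`
is the Levi-Civita connection of `M`. -/
def secondFundamentalForm (F : C^∞⟮𝓘(ℝ, E), M; 𝓘(ℝ, E'), N⟯) (X Y : Π q : M, TangentSpace 𝓘(ℝ, E) q) (p : M) :
    TangentSpace 𝓘(ℝ, E') (F p) :=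
  covDerivAlong F (fun q ↦ differential F q (Y q)) p (X p)
    - differential F p (leviCivita Y p (X p))

/-- `F` is a totally geodesic submanifold: `σ = 0`. -/
def IsTotallyGeodesic (F : C^∞⟮𝓘(ℝ, E), M; 𝓘(ℝ, E'), N⟯) : Prop :=
  ∀ (p : M) (X Y : Π q : M, TangentSpace 𝓘(ℝ, E) q),
    CMDiffAt ∞ (T% X) p → CMDiffAt ∞ (T% Y) p → secondFundamentalForm F X Y p = 0

/-- `F` is a semiparallel submanifold:
`R^⊥(X, Y)σ(Z, U) - σ(R(X, Y)Z, U) - σ(Z, R(X, Y)U) = 0`. -/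
def IsSemiparallel (F : C^∞⟮𝓘(ℝ, E), M; 𝓘(ℝ, E'), N⟯) : Prop :=
  ∀ (p : M) (X Y Z U : Π q : M, TangentSpace 𝓘(ℝ, E) q),
    CMDiffAt ∞ (T% X) p → CMDiffAt ∞ (T% Y) p → CMDiffAt ∞ (T% Z) p → CMDiffAt ∞ (T% U) p →
      normalCurvature F X Y (secondFundamentalForm F Z U) p
        - secondFundamentalForm F (curvature X Y Z) U p
        - secondFundamentalForm F Z (curvature X Y U) p = 0

end Submanifold

end TotallyReal
end

/-! Only c ≠ 0 needs work, since a curvature tensor of constant sectional curvature 0 vanishes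
(`HasConstantCurvature.curvatureTensor_eq`). Write JX for J(dF X).

For tangent Y the field JY is normal and f(JY) = (J²Y)^⊥ = 0. Parallelity of f gives f(D_X JY) = 0.
Since D_X JY = J∇_X Y + (Jσ(X,Y))^⊥, the vector J((Jσ(X,Y))^⊥) is tangent, and as σ is normal this
forces σ(X,Y) ∈ J(TM) (`exists_sffTensor_eq`). Consequently D_X JW = J∇_X W and R^⊥(X,Y)JW = J
R(X,Y)W: the subbundle J(TM) that contains σ is a copy of the tangent bundle together with its
connection.

The cubic form C(u,v,w) = ⟨σ(u,v), Jw⟩ is totally symmetric, and semiparallelity says that each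
R(x,y), acting as a derivation, kills C (`cubicForm_curvatureTensor`). When c ≠ 0 these R(x,y) are,
up to the factor c, the infinitesimal rotations, and in dimension > 1 no nonzero symmetric cubic
form is invariant under them (`cubic_eq_zero`). So C = 0, and σ = 0 because σ lies in J(TM).

If σ = 0, the curvature of N restricts to that of M (`curvatureTensor_differential`), while totally
real planes of a complex space form have sectional curvature μ/4
(`IsCurvatureLike.totallyReal_sectional`). Hence c = μ/4.

The rest is the calculus behind this. `covDerivAlong` is defined in a chart; it is shown to satisfy
the Leibniz and chain rules, to be metric and torsion free, to commute with J, and to have the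
pulled back curvature (`curvatureAlong_eq`). The main device is induction over fields along F, which
are locally combinations of restrictions of fields of N. -/

noncomputable section

namespace TotallyReal

/-! ### Vector fields along a map -/

section Along

variable {E : Type*} [NormedAddCommGroup E] [NormedSpace ℝ E]
  {M : Type*} [TopologicalSpace M] [ChartedSpace E M]
  {E' : Type*} [NormedAddCommGroup E'] [NormedSpace ℝ E']
  {N : Type*} [TopologicalSpace N] [ChartedSpace E' N] [IsManifold 𝓘(ℝ, E') ∞ N]
  {F : C^∞⟮𝓘(ℝ, E), M; 𝓘(ℝ, E'), N⟯} {p : M}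

/-- The vector field `V` along `F` is differentiable at `p`. -/
def MDiffAlongAt (F : C^∞⟮𝓘(ℝ, E), M; 𝓘(ℝ, E'), N⟯)
    (V : Π q : M, TangentSpace 𝓘(ℝ, E') (F q)) (p : M) : Prop :=
  MDifferentiableAt 𝓘(ℝ, E) (𝓘(ℝ, E').prod 𝓘(ℝ, E'))
    (fun q ↦ TotalSpace.mk' E' (E := fun x : N ↦ TangentSpace 𝓘(ℝ, E') x) (F q) (V q)) p

/-- The coordinates of the vector field `V` along `F` in the chart of `N` at `F p`. -/
def coordAlong (F : C^∞⟮𝓘(ℝ, E), M; 𝓘(ℝ, E'), N⟯) (p : M)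
    (V : Π q : M, TangentSpace 𝓘(ℝ, E') (F q)) (q : M) : E' :=
  (trivializationAt E' (fun x : N ↦ TangentSpace 𝓘(ℝ, E') x) (F p) ⟨F q, V q⟩).2

theorem mdiffAlongAt_iff {V : Π q : M, TangentSpace 𝓘(ℝ, E') (F q)} :
    MDiffAlongAt F V p ↔ MDiffAt (coordAlong F p V) p := by
  unfold MDiffAlongAt coordAlong
  rw [mdifferentiableAt_totalSpace]
  exact and_iff_right (F.contMDiff.mdifferentiableAt (by simp))

theorem smoothAlongAt_iff {V : Π q : M, TangentSpace 𝓘(ℝ, E') (F q)} :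
    SmoothAlongAt F V p ↔ CMDiffAt ∞ (coordAlong F p V) p := by
  unfold SmoothAlongAt coordAlong
  rw [contMDiffAt_totalSpace]
  exact and_iff_right F.contMDiff.contMDiffAt

theorem SmoothAlongAt.mdiffAlongAt {V : Π q : M, TangentSpace 𝓘(ℝ, E') (F q)}
    (h : SmoothAlongAt F V p) : MDiffAlongAt F V p :=
  ContMDiffAt.mdifferentiableAt h (by simp)

/-- Smoothness at p yields a neighbourhood for each finite order, with no common one in general;
order 1 is enough for first derivatives to obey the calculus rules near p, as second derivatives at
p require. -/
theorem SmoothAlongAt.eventually_mdiffAlongAt [IsManifold 𝓘(ℝ, E) ∞ M]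
    {V : Π q : M, TangentSpace 𝓘(ℝ, E') (F q)}
    (h : SmoothAlongAt F V p) : ∀ᶠ q in 𝓝 p, MDiffAlongAt F V q := by
  have : IsManifold 𝓘(ℝ, E) 1 M := .of_le (n := ∞) (by simp)
  have h1 := (contMDiffAt_iff_contMDiffAt_nhds (by simp)).1
    (ContMDiffAt.of_le h (show (1 : WithTop ℕ∞) ≤ ∞ by simp))
  exact h1.mono fun q hq ↦ hq.mdifferentiableAt (by simp)

theorem eventually_mem_baseSet (F : C^∞⟮𝓘(ℝ, E), M; 𝓘(ℝ, E'), N⟯) (p : M) :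
    ∀ᶠ q in 𝓝 p,
      F q ∈ (trivializationAt E' (fun x : N ↦ TangentSpace 𝓘(ℝ, E') x) (F p)).baseSet :=
  F.contMDiff.continuous.continuousAt.eventually_mem
    ((Trivialization.open_baseSet _).mem_nhds (mem_baseSet_trivializationAt' _))

/-- The trivialization is linear on fibres over its base set only, hence equality near p instead of
everywhere. -/
theorem coordAlong_add {V W : Π q : M, TangentSpace 𝓘(ℝ, E') (F q)} :
    coordAlong F p (fun q ↦ V q + W q) =ᶠ[𝓝 p]
      fun q ↦ coordAlong F p V q + coordAlong F p W q :=
  (eventually_mem_baseSet F p).mono fun _ hq ↦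
    ((trivializationAt E' (fun x : N ↦ TangentSpace 𝓘(ℝ, E') x) (F p)).linear ℝ hq).map_add _ _

theorem coordAlong_smul {f : M → ℝ} {V : Π q : M, TangentSpace 𝓘(ℝ, E') (F q)} :
    coordAlong F p (fun q ↦ f q • V q) =ᶠ[𝓝 p] fun q ↦ f q • coordAlong F p V q :=
  (eventually_mem_baseSet F p).mono fun _ hq ↦
    ((trivializationAt E' (fun x : N ↦ TangentSpace 𝓘(ℝ, E') x) (F p)).linear ℝ hq).map_smul _ _

theorem coordAlong_congr {V W : Π q : M, TangentSpace 𝓘(ℝ, E') (F q)}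
    (h : ∀ᶠ q in 𝓝 p, V q = W q) : coordAlong F p V =ᶠ[𝓝 p] coordAlong F p W :=
  h.mono fun q hq ↦ by simp [coordAlong, hq]

variable {V W : Π q : M, TangentSpace 𝓘(ℝ, E') (F q)} {f : M → ℝ}

theorem SmoothAlongAt.congr (hV : SmoothAlongAt F V p) (h : ∀ᶠ q in 𝓝 p, V q = W q) :
    SmoothAlongAt F W p :=
  smoothAlongAt_iff.2 <| (smoothAlongAt_iff.1 hV).congr_of_eventuallyEq (coordAlong_congr h).symm

theorem MDiffAlongAt.add (hV : MDiffAlongAt F V p) (hW : MDiffAlongAt F W p) :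
    MDiffAlongAt F (fun q ↦ V q + W q) p :=
  mdiffAlongAt_iff.2 <|
    ((mdiffAlongAt_iff.1 hV).add (mdiffAlongAt_iff.1 hW)).congr_of_eventuallyEq coordAlong_add

theorem SmoothAlongAt.add (hV : SmoothAlongAt F V p) (hW : SmoothAlongAt F W p) :
    SmoothAlongAt F (fun q ↦ V q + W q) p :=
  smoothAlongAt_iff.2 <|
    ((smoothAlongAt_iff.1 hV).add (smoothAlongAt_iff.1 hW)).congr_of_eventuallyEq coordAlong_add

theorem MDiffAlongAt.smul (hf : MDiffAt f p) (hV : MDiffAlongAt F V p) :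
    MDiffAlongAt F (fun q ↦ f q • V q) p :=
  mdiffAlongAt_iff.2 <|
    (hf.smul (mdiffAlongAt_iff.1 hV)).congr_of_eventuallyEq coordAlong_smul

theorem SmoothAlongAt.smul (hf : CMDiffAt ∞ f p) (hV : SmoothAlongAt F V p) :
    SmoothAlongAt F (fun q ↦ f q • V q) p :=
  smoothAlongAt_iff.2 <|
    (hf.smul (smoothAlongAt_iff.1 hV)).congr_of_eventuallyEq coordAlong_smul

theorem SmoothAlongAt.neg (hV : SmoothAlongAt F V p) : SmoothAlongAt F (fun q ↦ -V q) p :=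
  (hV.smul (f := fun _ ↦ -1) contMDiffAt_const).congr (.of_forall fun q ↦ neg_one_smul ℝ (V q))

theorem SmoothAlongAt.sub (hV : SmoothAlongAt F V p) (hW : SmoothAlongAt F W p) :
    SmoothAlongAt F (fun q ↦ V q - W q) p :=
  (hV.add hW.neg).congr (.of_forall fun q ↦ (sub_eq_add_neg (V q) (W q)).symm)

theorem MDiffAlongAt.comp {S : Π x : N, TangentSpace 𝓘(ℝ, E') x} (hS : MDiffAt (T% S) (F p)) :
    MDiffAlongAt F (fun q ↦ S (F q)) p :=
  MDifferentiableAt.comp (g := T% S) (f := F) p hS (F.contMDiff.mdifferentiableAt (by simp))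

theorem SmoothAlongAt.comp {S : Π x : N, TangentSpace 𝓘(ℝ, E') x} (hS : CMDiffAt ∞ (T% S) (F p)) :
    SmoothAlongAt F (fun q ↦ S (F q)) p :=
  ContMDiffAt.comp (g := T% S) (f := F) p hS F.contMDiff.contMDiffAt

/-- The differential of `F` maps smooth vector fields to smooth vector fields along `F`. -/
theorem SmoothAlongAt.differential [IsManifold 𝓘(ℝ, E) ∞ M] {X : Π q : M, TangentSpace 𝓘(ℝ, E) q}
    (hX : CMDiffAt ∞ (T% X) p) :
    SmoothAlongAt F (fun q ↦ differential F q (X q)) p :=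
  ContMDiffAt.comp (g := tangentMap 𝓘(ℝ, E) 𝓘(ℝ, E') F) (f := T% X) p
    (F.contMDiff.contMDiff_tangentMap (m := ∞) (by simp)).contMDiffAt hX

theorem MDiffAlongAt.differential [IsManifold 𝓘(ℝ, E) ∞ M] {X : Π q : M, TangentSpace 𝓘(ℝ, E) q}
    (hX : MDiffAt (T% X) p) :
    MDiffAlongAt F (fun q ↦ differential F q (X q)) p :=
  MDifferentiableAt.comp (g := tangentMap 𝓘(ℝ, E) 𝓘(ℝ, E') F) (f := T% X) p
    ((F.contMDiff.contMDiff_tangentMap (m := ∞) (by simp)).mdifferentiableAt (by simp)) hX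

theorem eventually_mem_baseSet_trivializationAt (x : N) :
    ∀ᶠ y in 𝓝 x, y ∈ (trivializationAt E' (fun x : N ↦ TangentSpace 𝓘(ℝ, E') x) x).baseSet :=
  (trivializationAt E' (fun x : N ↦ TangentSpace 𝓘(ℝ, E') x) x).open_baseSet.mem_nhds
    (mem_baseSet_trivializationAt' x)

/-- Near x the field `extend E' v` has constant coordinates, those of v, so it depends linearly on
v. This makes the second term of `covDerivAlong` linear in the value of the field. -/
theorem extend_eq_symmL {x y : N} (v : TangentSpace 𝓘(ℝ, E') x)
    (hy : y ∈ (trivializationAt E' (fun x : N ↦ TangentSpace 𝓘(ℝ, E') x) x).baseSet) :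
    extend E' v y = (trivializationAt E' (fun x : N ↦ TangentSpace 𝓘(ℝ, E') x) x).symmL ℝ y
      ((trivializationAt E' (fun x : N ↦ TangentSpace 𝓘(ℝ, E') x) x).continuousLinearMapAt
        ℝ x v) := by
  rw [Trivialization.symmL_apply _ hy,
    Trivialization.continuousLinearMapAt_apply_of_mem ℝ _ (mem_baseSet_trivializationAt' x)]
  rfl

theorem symmL_coordAlong :
    (trivializationAt E' (fun x : N ↦ TangentSpace 𝓘(ℝ, E') x) (F p)).symmL ℝ (F p)
      (coordAlong F p V p) = V p := by
  rw [Trivialization.symmL_apply _ (mem_baseSet_trivializationAt' _)]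
  exact Trivialization.symm_apply_apply_mk _ (mem_baseSet_trivializationAt' _) _

theorem mvfderiv_congr {G : Type*} [NormedAddCommGroup G] [NormedSpace ℝ G] {g h : M → G}
    (hgh : g =ᶠ[𝓝 p] h) : d% g p = d% h p := by
  have h0 := hgh.eq_of_nhds
  ext v
  exact congrArg (fun L : E →L[ℝ] G ↦ L v) (hgh.mfderiv_eq (I := 𝓘(ℝ, E)) (I' := 𝓘(ℝ, G)))

variable [FiniteDimensional ℝ E']

/-- The local frame of coordinate vector fields of the chart at `x`. -/
def coordFrame (x : N) (a : Fin (finrank ℝ E')) (y : N) : TangentSpace 𝓘(ℝ, E') y :=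
  (trivializationAt E' (fun x : N ↦ TangentSpace 𝓘(ℝ, E') x) x).symm y (finBasis ℝ E' a)

theorem contMDiffAt_coordFrame (x : N) (a : Fin (finrank ℝ E')) :
    CMDiffAt ∞ (T% (coordFrame x a)) x := by
  rw [contMDiffAt_section]
  refine (contMDiffAt_const (c := finBasis ℝ E' a)).congr_of_eventuallyEq ?_
  filter_upwards [(trivializationAt E' (fun x : N ↦ TangentSpace 𝓘(ℝ, E') x) x).open_baseSet.mem_nhds
    (mem_baseSet_trivializationAt' x)] with y hy
  exact congrArg Prod.snd (Trivialization.apply_mk_symm _ hy _)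

/-- The coefficients of a vector field along `F` in the coordinate frame at `F p`. -/
def coeffAlong (F : C^∞⟮𝓘(ℝ, E), M; 𝓘(ℝ, E'), N⟯) (p : M)
    (V : Π q : M, TangentSpace 𝓘(ℝ, E') (F q)) (a : Fin (finrank ℝ E')) (q : M) : ℝ :=
  (finBasis ℝ E').coord a (coordAlong F p V q)

theorem eventually_eq_sum_coordFrame (F : C^∞⟮𝓘(ℝ, E), M; 𝓘(ℝ, E'), N⟯) (p : M)
    (V : Π q : M, TangentSpace 𝓘(ℝ, E') (F q)) :
    ∀ᶠ q in 𝓝 p, ∑ a, coeffAlong F p V a q • coordFrame (F p) a (F q) = V q := by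
  filter_upwards [eventually_mem_baseSet F p] with q hq
  set t := trivializationAt E' (fun x : N ↦ TangentSpace 𝓘(ℝ, E') x) (F p)
  have h : ∀ e : E', t.symm (F q) e = t.symmL ℝ (F q) e := fun e ↦ (t.symmL_apply hq e).symm
  simp only [coordFrame, h, t]
  simp_rw [← map_smul, ← map_sum, coeffAlong, Basis.coord_apply, Basis.sum_repr]
  rw [← h]
  exact Trivialization.symm_apply_apply_mk t hq (V q)

theorem sum_coeffAlong (V : Π q : M, TangentSpace 𝓘(ℝ, E') (F q)) :
    V p = ∑ a, coeffAlong F p V a p • coordFrame (F p) a (F p) :=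
  (eventually_eq_sum_coordFrame F p V).self_of_nhds.symm

theorem mdifferentiableAt_coeffAlong (hV : MDiffAlongAt F V p) (a : Fin (finrank ℝ E')) :
    MDiffAt (coeffAlong F p V a) p := by
  have h := mdiffAlongAt_iff.1 hV
  exact (((finBasis ℝ E').coord a).toContinuousLinearMap.differentiable.differentiableAt
    |>.mdifferentiableAt).comp p h

theorem contMDiffAt_coeffAlong (hV : SmoothAlongAt F V p) (a : Fin (finrank ℝ E')) :
    CMDiffAt ∞ (coeffAlong F p V a) p := by
  have h := smoothAlongAt_iff.1 hV
  exact (((finBasis ℝ E').coord a).toContinuousLinearMap.contDiff.contMDiff).contMDiffAt.comp p h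

/-- To prove a property of differentiable vector fields along `F`, it suffices to consider
restrictions of vector fields of `N`, sums, and products with functions. -/
theorem MDiffAlongAt.induction {Q : (Π q : M, TangentSpace 𝓘(ℝ, E') (F q)) → Prop}
    (congr : ∀ V W, MDiffAlongAt F V p → (∀ᶠ q in 𝓝 p, V q = W q) → Q V → Q W)
    (add : ∀ V W, MDiffAlongAt F V p → MDiffAlongAt F W p → Q V → Q W → Q (fun q ↦ V q + W q))
    (smul : ∀ (f : M → ℝ) V, MDiffAt f p → MDiffAlongAt F V p → Q V → Q (fun q ↦ f q • V q))
    (comp : ∀ S : Π x : N, TangentSpace 𝓘(ℝ, E') x, CMDiffAt ∞ (T% S) (F p) →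
      Q (fun q ↦ S (F q)))
    (hV : MDiffAlongAt F V p) : Q V := by
  -- Differentiability of the partial sums is carried along with Q because the `add` case asks for
  -- it.
  have key : ∀ s : Finset (Fin (finrank ℝ E')),
      MDiffAlongAt F (fun q ↦ ∑ a ∈ s, coeffAlong F p V a q • coordFrame (F p) a (F q)) p ∧
      Q (fun q ↦ ∑ a ∈ s, coeffAlong F p V a q • coordFrame (F p) a (F q)) := by
    intro s
    induction s using Finset.induction_on with
    | empty =>
      simp only [Finset.sum_empty]
      have h0 : CMDiffAt ∞ (T% (0 : Π x : N, TangentSpace 𝓘(ℝ, E') x)) (F p) :=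
        (contMDiff_zeroSection ℝ (fun x : N ↦ TangentSpace 𝓘(ℝ, E') x)).contMDiffAt
      exact ⟨(SmoothAlongAt.comp h0).mdiffAlongAt, comp _ h0⟩
    | insert a s ha ih =>
      simp only [Finset.sum_insert ha]
      have h1 := contMDiffAt_coordFrame (F p) a
      have h2 := mdifferentiableAt_coeffAlong hV a
      have h3 := (SmoothAlongAt.comp h1).mdiffAlongAt
      exact ⟨(h3.smul h2).add ih.1, add _ _ (h3.smul h2) ih.1 (smul _ _ h2 h3 (comp _ h1)) ih.2⟩
  exact congr _ _ (key Finset.univ).1 (eventually_eq_sum_coordFrame F p V) (key Finset.univ).2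

/-- To prove a property of smooth vector fields along `F`, it suffices to consider
coordinate vector fields of `N`, sums, and products with functions. -/
theorem SmoothAlongAt.induction_coordFrame
    {Q : (Π q : M, TangentSpace 𝓘(ℝ, E') (F q)) → Prop}
    (congr : ∀ V W, SmoothAlongAt F V p → (∀ᶠ q in 𝓝 p, V q = W q) → Q V → Q W)
    (zero : Q (fun _ ↦ 0))
    (add : ∀ V W, SmoothAlongAt F V p → SmoothAlongAt F W p → Q V → Q W → Q (fun q ↦ V q + W q))
    (smul : ∀ (f : M → ℝ) V, CMDiffAt ∞ f p → SmoothAlongAt F V p → Q V → Q (fun q ↦ f q • V q))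
    (frame : ∀ a, Q (fun q ↦ coordFrame (F p) a (F q)))
    (hV : SmoothAlongAt F V p) : Q V := by
  have key : ∀ s : Finset (Fin (finrank ℝ E')),
      SmoothAlongAt F (fun q ↦ ∑ a ∈ s, coeffAlong F p V a q • coordFrame (F p) a (F q)) p ∧
      Q (fun q ↦ ∑ a ∈ s, coeffAlong F p V a q • coordFrame (F p) a (F q)) := by
    intro s
    induction s using Finset.induction_on with
    | empty =>
      simp only [Finset.sum_empty]
      have h0 : CMDiffAt ∞ (T% (0 : Π x : N, TangentSpace 𝓘(ℝ, E') x)) (F p) :=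
        (contMDiff_zeroSection ℝ (fun x : N ↦ TangentSpace 𝓘(ℝ, E') x)).contMDiffAt
      exact ⟨SmoothAlongAt.comp h0, zero⟩
    | insert a s ha ih =>
      simp only [Finset.sum_insert ha]
      have h1 := contMDiffAt_coordFrame (F p) a
      have h2 := contMDiffAt_coeffAlong hV a
      have h3 := SmoothAlongAt.comp h1
      exact ⟨(h3.smul h2).add ih.1, add _ _ (h3.smul h2) ih.1 (smul _ _ h2 h3 (frame a)) ih.2⟩
  exact congr _ _ (key Finset.univ).1 (eventually_eq_sum_coordFrame F p V) (key Finset.univ).2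

/-- To prove a property of smooth vector fields along `F`, it suffices to consider
restrictions of vector fields of `N`, sums, and products with functions. -/
theorem SmoothAlongAt.induction {Q : (Π q : M, TangentSpace 𝓘(ℝ, E') (F q)) → Prop}
    (congr : ∀ V W, SmoothAlongAt F V p → (∀ᶠ q in 𝓝 p, V q = W q) → Q V → Q W)
    (add : ∀ V W, SmoothAlongAt F V p → SmoothAlongAt F W p → Q V → Q W → Q (fun q ↦ V q + W q))
    (smul : ∀ (f : M → ℝ) V, CMDiffAt ∞ f p → SmoothAlongAt F V p → Q V → Q (fun q ↦ f q • V q))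
    (comp : ∀ S : Π x : N, TangentSpace 𝓘(ℝ, E') x, CMDiffAt ∞ (T% S) (F p) →
      Q (fun q ↦ S (F q)))
    (hV : SmoothAlongAt F V p) : Q V :=
  hV.induction_coordFrame congr
    (comp 0 (contMDiff_zeroSection ℝ (fun x : N ↦ TangentSpace 𝓘(ℝ, E') x)).contMDiffAt) add smul
    fun a ↦ comp _ (contMDiffAt_coordFrame (F p) a)

end Along

/-! ### The covariant derivative along a map -/

section CovDerivAlong

variable {E : Type*} [NormedAddCommGroup E] [NormedSpace ℝ E]
  {M : Type*} [TopologicalSpace M] [ChartedSpace E M]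
  {E' : Type*} [NormedAddCommGroup E'] [NormedSpace ℝ E'] [FiniteDimensional ℝ E']
  {N : Type*} [TopologicalSpace N] [ChartedSpace E' N] [IsManifold 𝓘(ℝ, E') ∞ N]
  [RiemannianBundle (fun x : N ↦ TangentSpace 𝓘(ℝ, E') x)]
  [IsContMDiffRiemannianBundle 𝓘(ℝ, E') ∞ E' (fun x : N ↦ TangentSpace 𝓘(ℝ, E') x)]
  {F : C^∞⟮𝓘(ℝ, E), M; 𝓘(ℝ, E'), N⟯} {p : M}
  {V W : Π q : M, TangentSpace 𝓘(ℝ, E') (F q)} {f : M → ℝ}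

theorem leviCivita_add {S T : Π x : N, TangentSpace 𝓘(ℝ, E') x} {x : N}
    (hS : MDiffAt (T% S) x) (hT : MDiffAt (T% T) x) :
    leviCivita (S + T) x = leviCivita S x + leviCivita T x :=
  leviCivita.isCovariantDerivativeOn.add hS hT

theorem leviCivita_smul {S : Π x : N, TangentSpace 𝓘(ℝ, E') x} {g : N → ℝ} {x : N}
    (hg : MDiffAt g x) (hS : MDiffAt (T% S) x) :
    leviCivita (g • S) x = g x • leviCivita S x + (d% g x).smulRight (S x) :=
  leviCivita.isCovariantDerivativeOn.leibniz hS hg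

theorem leviCivita_const_smul {S : Π x : N, TangentSpace 𝓘(ℝ, E') x} (c : ℝ) {x : N}
    (hS : MDiffAt (T% S) x) : leviCivita (c • S) x = c • leviCivita S x :=
  leviCivita.isCovariantDerivativeOn.smul_const c hS

theorem leviCivita_congr {S T : Π x : N, TangentSpace 𝓘(ℝ, E') x} {x : N}
    (hS : MDiffAt (T% S) x) (h : ∀ᶠ y in 𝓝 x, S y = T y) : leviCivita S x = leviCivita T x := by
  have hT : MDiffAt (T% T) x := by
    refine hS.congr_of_eventuallyEq ?_
    filter_upwards [h] with y hy
    rw [hy]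
  exact leviCivita.isCovariantDerivativeOn.congr_of_eventuallyEq hS hT Filter.univ_mem h

theorem leviCivita_extend_add {x : N} (v w : TangentSpace 𝓘(ℝ, E') x) :
    leviCivita (extend E' (v + w)) x = leviCivita (extend E' v) x + leviCivita (extend E' w) x := by
  rw [← leviCivita_add (mdifferentiableAt_extend 𝓘(ℝ, E') E' v)
    (mdifferentiableAt_extend 𝓘(ℝ, E') E' w)]
  refine leviCivita_congr (mdifferentiableAt_extend 𝓘(ℝ, E') E' (v + w)) ?_
  filter_upwards [eventually_mem_baseSet_trivializationAt (E' := E') x] with y hy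
  rw [Pi.add_apply, extend_eq_symmL _ hy, extend_eq_symmL _ hy, extend_eq_symmL _ hy, map_add,
    map_add]

theorem leviCivita_extend_smul {x : N} (c : ℝ) (v : TangentSpace 𝓘(ℝ, E') x) :
    leviCivita (extend E' (c • v)) x = c • leviCivita (extend E' v) x := by
  rw [← leviCivita_const_smul c (mdifferentiableAt_extend 𝓘(ℝ, E') E' v)]
  refine leviCivita_congr (mdifferentiableAt_extend 𝓘(ℝ, E') E' (c • v)) ?_
  filter_upwards [eventually_mem_baseSet_trivializationAt (E' := E') x] with y hy
  rw [Pi.smul_apply, extend_eq_symmL _ hy, extend_eq_symmL _ hy, map_smul, map_smul]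

theorem covDerivAlong_apply (V : Π q : M, TangentSpace 𝓘(ℝ, E') (F q))
    (u : TangentSpace 𝓘(ℝ, E) p) :
    covDerivAlong F V p u =
      (trivializationAt E' (fun x : N ↦ TangentSpace 𝓘(ℝ, E') x) (F p)).symmL ℝ (F p)
        (d% (coordAlong F p V) p u)
      + leviCivita (extend E' (V p)) (F p) (differential F p u) :=
  rfl

theorem covDerivAlong_congr (h : ∀ᶠ q in 𝓝 p, V q = W q) :
    covDerivAlong F V p = covDerivAlong F W p := by
  ext u
  rw [covDerivAlong_apply, covDerivAlong_apply, mvfderiv_congr (coordAlong_congr h), h.self_of_nhds]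

theorem covDerivAlong_add (hV : MDiffAlongAt F V p) (hW : MDiffAlongAt F W p) :
    covDerivAlong F (fun q ↦ V q + W q) p = covDerivAlong F V p + covDerivAlong F W p := by
  ext u
  rw [add_apply, covDerivAlong_apply, covDerivAlong_apply, covDerivAlong_apply,
    mvfderiv_congr coordAlong_add,
    mvfderiv_fun_add (mdiffAlongAt_iff.1 hV) (mdiffAlongAt_iff.1 hW), leviCivita_extend_add,
    add_apply, add_apply, map_add]
  abel

theorem covDerivAlong_smul (hf : MDiffAt f p) (hV : MDiffAlongAt F V p)
    (u : TangentSpace 𝓘(ℝ, E) p) :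
    covDerivAlong F (fun q ↦ f q • V q) p u = d% f p u • V p + f p • covDerivAlong F V p u := by
  rw [covDerivAlong_apply, covDerivAlong_apply,
    mvfderiv_congr coordAlong_smul,
    mvfderiv_fun_smul hf (mdiffAlongAt_iff.1 hV), leviCivita_extend_smul]
  simp only [add_apply, smul_apply,
    ContinuousLinearMap.smulRight_apply, map_add, map_smul]
  rw [symmL_coordAlong]
  module

/-- The chain rule for covariant derivatives. -/
theorem covDerivAlong_comp {S : Π x : N, TangentSpace 𝓘(ℝ, E') x} (hS : MDiffAt (T% S) (F p))
    (u : TangentSpace 𝓘(ℝ, E) p) :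
    covDerivAlong F (fun q ↦ S (F q)) p u = leviCivita S (F p) (differential F p u) := by
  set t := trivializationAt E' (fun x : N ↦ TangentSpace 𝓘(ℝ, E') x) (F p) with ht
  let coord (S : Π x : N, TangentSpace 𝓘(ℝ, E') x) (y : N) : E' := (t ⟨y, S y⟩).2
  have hF := eventually_mem_baseSet_trivializationAt (E' := E') (F p)
  have hid (S : Π x : N, TangentSpace 𝓘(ℝ, E') x) (hS : MDiffAt (T% S) (F p)) :
      MDiffAt (coord S) (F p) := mdifferentiableAt_section _ _ |>.1 hS
  -- The connection minus the coordinatewise derivative has no derivative term left, so it depends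
  -- on S only through S (F p). It may be evaluated on `extend E' (S (F p))`, whose coordinates have
  -- derivative zero (`h0`).
  have key : TensorialAt 𝓘(ℝ, E') E' (fun S : Π x : N, TangentSpace 𝓘(ℝ, E') x ↦
      leviCivita S (F p) - (t.symmL ℝ (F p)).comp (d% (coord S) (F p))) (F p) := by
    constructor
    · intro g S hg hS
      have h1 : coord (g • S) =ᶠ[𝓝 (F p)] fun y ↦ g y • coord S y :=
        hF.mono fun y hy ↦ (t.linear ℝ hy).map_smul _ _
      have h2 : (t.symmL ℝ (F p)) (coord S (F p)) = S (F p) :=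
        symmL_coordAlong (F := F) (p := p) (V := fun q ↦ S (F q))
      ext v
      rw [leviCivita_smul hg hS, mvfderiv_congr h1, mvfderiv_fun_smul hg (hid S hS)]
      simp [h2, smul_sub]
    · intro S T hS hT
      have h1 : coord (S + T) =ᶠ[𝓝 (F p)] fun y ↦ coord S y + coord T y :=
        hF.mono fun y hy ↦ (t.linear ℝ hy).map_add _ _
      ext v
      rw [leviCivita_add hS hT, mvfderiv_congr h1, mvfderiv_fun_add (hid S hS) (hid T hT)]
      simp only [add_apply, map_add, sub_apply, ContinuousLinearMap.comp_apply]
      abel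
  have h0 : d% (coord (extend E' (S (F p)))) (F p) = 0 := by
    rw [← mvfderiv_const (I := 𝓘(ℝ, E')) (t ⟨F p, S (F p)⟩).2 (x := F p)]
    refine mvfderiv_congr (hF.mono fun y hy ↦ ?_)
    change (t ⟨y, t.symm y (t ⟨F p, S (F p)⟩).2⟩).2 = _
    rw [t.apply_mk_symm hy]
  have h1 := key.pointwise hS (mdifferentiableAt_extend 𝓘(ℝ, E') E' (S (F p)))
    (extend_apply_self _ _).symm
  rw [h0, ContinuousLinearMap.comp_zero, sub_zero] at h1
  have h2 : d% (coordAlong F p (fun q ↦ S (F q))) p u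
      = d% (coord S) (F p) (differential F p u) :=
    mfderiv_comp_apply p (hid S hS) (F.contMDiff.mdifferentiableAt (by simp)) u
  rw [covDerivAlong_apply, ← h1, h2, sub_apply, ContinuousLinearMap.comp_apply]
  abel

end CovDerivAlong

/-! ### Inner products of sections along a map. -/

section RiemannianBundles

variable {EB : Type*} [NormedAddCommGroup EB] [NormedSpace ℝ EB]
  {HB : Type*} [TopologicalSpace HB] {IB : ModelWithCorners ℝ EB HB}
  {B : Type*} [TopologicalSpace B] [ChartedSpace HB B]
  {F : Type*} [NormedAddCommGroup F] [NormedSpace ℝ F] {V : B → Type*}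
  [TopologicalSpace (TotalSpace F V)] [∀ b, TopologicalSpace (V b)]
  [∀ b, AddCommGroup (V b)] [∀ b, Module ℝ (V b)]
  [∀ b, IsTopologicalAddGroup (V b)] [∀ b, ContinuousConstSMul ℝ (V b)]
  [FiberBundle F V] [VectorBundle ℝ F V] [RiemannianBundle V]
  {EM : Type*} [NormedAddCommGroup EM] [NormedSpace ℝ EM]
  {HM : Type*} [TopologicalSpace HM] {IM : ModelWithCorners ℝ EM HM}
  {M : Type*} [TopologicalSpace M] [ChartedSpace HM M]
  {b : M → B} {v w : Π x, V (b x)} {x : M}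

theorem contMDiffAt_inner_bundle {n : WithTop ℕ∞} [IsContMDiffRiemannianBundle IB n F V]
    (hv : CMDiffAt n (fun m ↦ (v m : TotalSpace F V)) x)
    (hw : CMDiffAt n (fun m ↦ (w m : TotalSpace F V)) x) :
    CMDiffAt n (fun m ↦ inner ℝ (v m) (w m)) x :=
  hv.inner_bundle hw

theorem mdifferentiableAt_inner_bundle_comp [IsContMDiffRiemannianBundle IB 1 F V]
    (hv : MDiffAt (fun m ↦ (v m : TotalSpace F V)) x)
    (hw : MDiffAt (fun m ↦ (w m : TotalSpace F V)) x) :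
    MDiffAt (fun m ↦ inner ℝ (v m) (w m)) x :=
  hv.inner_bundle hw

end RiemannianBundles

/-! ### Smoothness of derivatives, Lie brackets and the Levi-Civita connection. -/

section Smoothness

variable {E : Type*} [NormedAddCommGroup E] [NormedSpace ℝ E]
  {M : Type*} [TopologicalSpace M] [ChartedSpace E M] [IsManifold 𝓘(ℝ, E) ∞ M]

theorem ContMDiffAt.eventually_mdifferentiableAt_section {X : Π q : M, TangentSpace 𝓘(ℝ, E) q}
    {p : M} (hX : CMDiffAt ∞ (T% X) p) : ∀ᶠ q in 𝓝 p, MDiffAt (T% X) q := by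
  have : IsManifold 𝓘(ℝ, E) 1 M := .of_le (n := ∞) (by simp)
  have h1 := (contMDiffAt_iff_contMDiffAt_nhds (by simp)).1
    (ContMDiffAt.of_le hX (show (1 : WithTop ℕ∞) ≤ ∞ by simp))
  exact h1.mono fun q hq ↦ hq.mdifferentiableAt (by simp)

theorem ContMDiffAt.eventually_mdifferentiableAt {G : Type*} [NormedAddCommGroup G]
    [NormedSpace ℝ G] {f : M → G}
    {p : M} (hf : CMDiffAt ∞ f p) : ∀ᶠ q in 𝓝 p, MDiffAt f q := by
  have : IsManifold 𝓘(ℝ, E) 1 M := .of_le (n := ∞) (by simp)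
  have h1 := (contMDiffAt_iff_contMDiffAt_nhds (by simp)).1
    (hf.of_le (show (1 : WithTop ℕ∞) ≤ ∞ by simp))
  exact h1.mono fun q hq ↦ hq.mdifferentiableAt (by simp)

theorem contMDiffAt_mvfderiv_apply {G : Type*} [NormedAddCommGroup G] [NormedSpace ℝ G] {f : M → G}
    {X : Π q : M, TangentSpace 𝓘(ℝ, E) q} {p : M}
    (hf : CMDiffAt ∞ f p) (hX : CMDiffAt ∞ (T% X) p) :
    CMDiffAt ∞ (fun q ↦ d% f q (X q)) p := by
  have h := ContMDiffAt.clm_apply_of_inCoordinates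
    (F₁ := E) (E₁ := TangentSpace 𝓘(ℝ, E)) (F₂ := G) (E₂ := TangentSpace 𝓘(ℝ, G))
    (b₁ := id) (b₂ := f) (hf.mfderiv_const (m := ∞) (by simp)) hX hf
  rw [contMDiffAt_totalSpace] at h
  refine h.2.congr_of_eventuallyEq (.of_forall fun q ↦ ?_)
  simp only [trivializationAt_model_space_apply]
  rfl

theorem contMDiffAt_mlieBracket [FiniteDimensional ℝ E] {X Y : Π q : M, TangentSpace 𝓘(ℝ, E) q} {p : M}
    (hX : CMDiffAt ∞ (T% X) p) (hY : CMDiffAt ∞ (T% Y) p) :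
    CMDiffAt ∞ (T% (mlieBracket 𝓘(ℝ, E) X Y)) p :=
  have : IsManifold 𝓘(ℝ, E) (minSmoothness ℝ 2) M :=
    .of_le (n := ∞) (by simpa using ENat.LEInfty.out)
  have : IsManifold 𝓘(ℝ, E) (((⊤ : ℕ∞) : WithTop ℕ∞) + 1) M := .of_le (n := ∞) (by simp)
  ContMDiffAt.mlieBracket_vectorField (m := ⊤) (n := ⊤) hX hY (by simp)

variable [FiniteDimensional ℝ E]
  [RiemannianBundle (fun x : M ↦ TangentSpace 𝓘(ℝ, E) x)]
  [IsContMDiffRiemannianBundle 𝓘(ℝ, E) ∞ E (fun x : M ↦ TangentSpace 𝓘(ℝ, E) x)]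

/-- A vector field is smooth if its inner products with smooth vector fields are. -/
theorem contMDiffAt_of_inner {S : Π x : M, TangentSpace 𝓘(ℝ, E) x} {x : M}
    (h : ∀ T : Π x : M, TangentSpace 𝓘(ℝ, E) x, CMDiffAt ∞ (T% T) x →
      CMDiffAt ∞ (fun y ↦ inner ℝ (S y) (T y)) x) : CMDiffAt ∞ (T% S) x := by
  classical
  set t := trivializationAt E (fun x : M ↦ TangentSpace 𝓘(ℝ, E) x) x with ht
  let b := finBasis ℝ E
  let e (a : Fin (finrank ℝ E)) := coordFrame (E' := E) x a
  have he (a) : CMDiffAt ∞ (T% (e a)) x := contMDiffAt_coordFrame x a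
  let L (a c : Fin (finrank ℝ E)) : E →L[ℝ] (Fin (finrank ℝ E) → ℝ) :=
    (b.coord a).toContinuousLinearMap.smulRight (Pi.single c 1)
  -- The Gram matrix of the coordinate frame: it sends the coordinates of a vector at y to its inner
  -- products with the frame. It is invertible at x, hence near x, with smooth inverse, and this
  -- inverse recovers the coordinates of S.
  let A (y : M) : E →L[ℝ] (Fin (finrank ℝ E) → ℝ) := ∑ a, ∑ c, (inner ℝ (e a y) (e c y) : ℝ) • L a c
  have hA : CMDiffAt ∞ A x := by
    refine ContMDiffAt.sum fun a _ ↦ ContMDiffAt.sum fun c _ ↦ ?_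
    exact (contMDiffAt_inner_bundle (he a) (he c)).smul contMDiffAt_const
  have hb : ∀ᶠ y in 𝓝 x, y ∈ t.baseSet := eventually_mem_baseSet_trivializationAt (E' := E) x
  have hsum : ∀ y ∈ t.baseSet, ∀ v : E, ∑ a, b.repr v a • e a y = t.symmL ℝ y v := by
    intro y hy v
    have h1 (a) : e a y = t.symmL ℝ y (b a) := (t.symmL_apply hy _).symm
    simp_rw [h1, ← map_smul, ← map_sum, Basis.sum_repr]
  have hAv : ∀ y ∈ t.baseSet, ∀ v : E, ∀ c, A y v c = inner ℝ (t.symmL ℝ y v) (e c y) := by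
    intro y hy v c
    rw [← hsum y hy v, sum_inner]
    simp [A, L, Finset.sum_apply, Pi.single_apply, inner_smul_left, mul_comm]
  have hinj : Function.Injective (A x) := by
    rw [injective_iff_map_eq_zero]
    intro v hv
    have hx := mem_baseSet_trivializationAt' (E := fun x : M ↦ TangentSpace 𝓘(ℝ, E) x) (F := E) x
    have h1 : t.symmL ℝ x v = 0 := by
      rw [← inner_self_eq_zero (𝕜 := ℝ)]
      nth_rw 2 [← hsum x hx v]
      rw [inner_sum]
      refine Finset.sum_eq_zero fun c _ ↦ ?_
      rw [inner_smul_right, ← hAv x hx v c, hv]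
      simp
    rw [← t.continuousLinearMapAt_symmL (R := ℝ) hx v, h1, map_zero]
  let eqv : E ≃L[ℝ] (Fin (finrank ℝ E) → ℝ) :=
    (LinearEquiv.ofInjectiveOfFinrankEq (A x).toLinearMap hinj (by simp)).toContinuousLinearEquiv
  have heqv : (eqv : E →L[ℝ] (Fin (finrank ℝ E) → ℝ)) = A x := by
    ext v
    rfl
  have hinv : CMDiffAt ∞ (fun y ↦ (A y).inverse) x := by
    have h1 : ContDiffAt ℝ ∞ ContinuousLinearMap.inverse (A x) := heqv ▸ contDiffAt_map_inverse eqv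
    exact h1.contMDiffAt.comp x hA
  have hev : ∀ᶠ y in 𝓝 x, ∃ e' : E ≃L[ℝ] (Fin (finrank ℝ E) → ℝ), (e' : E →L[ℝ] _) = A y :=
    hA.continuousAt.eventually (by rw [← heqv]; exact eqv.nhds)
  have hh : ContMDiffAt 𝓘(ℝ, E) 𝓘(ℝ, Fin (finrank ℝ E) → ℝ) ∞
      (fun y c ↦ inner ℝ (S y) (e c y)) x :=
    contMDiffAt_pi_space.2 fun c ↦ h _ (he c)
  rw [contMDiffAt_section]
  refine (hinv.clm_apply hh).congr_of_eventuallyEq ?_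
  filter_upwards [hb, hev] with y hy ⟨e', he'⟩
  rw [← he', ContinuousLinearMap.inverse_equiv]
  rw [eq_comm]
  change e'.symm _ = _
  rw [ContinuousLinearEquiv.symm_apply_eq]
  ext c
  change _ = (e' : E →L[ℝ] (Fin (finrank ℝ E) → ℝ)) _ c
  rw [he', hAv y hy, t.symmL_apply hy]
  congr 1
  exact (t.symm_apply_apply_mk hy _).symm

/-- The Levi-Civita connection is smooth. -/
theorem contMDiffAt_leviCivita {X Y : Π x : M, TangentSpace 𝓘(ℝ, E) x} {x : M}
    (hX : CMDiffAt ∞ (T% X) x) (hY : CMDiffAt ∞ (T% Y) x) :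
    CMDiffAt ∞ (T% (fun y ↦ leviCivita Y y (X y))) x := by
  refine contMDiffAt_of_inner fun Z hZ ↦ ?_
  have hi {X Y : Π x : M, TangentSpace 𝓘(ℝ, E) x} (hX : CMDiffAt ∞ (T% X) x)
      (hY : CMDiffAt ∞ (T% Y) x) : CMDiffAt ∞ (fun y ↦ inner ℝ (X y) (Y y)) x :=
    contMDiffAt_inner_bundle hX hY
  have hk : CMDiffAt ∞ (koszul Y X Z) x := by
    unfold koszul
    refine contMDiffAt_const.mul ?_
    refine (((((contMDiffAt_mvfderiv_apply (hi hY hZ) hX).add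
      (contMDiffAt_mvfderiv_apply (hi hX hZ) hY)).sub
      (contMDiffAt_mvfderiv_apply (hi hX hY) hZ)).add
      (hi (contMDiffAt_mlieBracket hX hY) hZ)).sub
      (hi (contMDiffAt_mlieBracket hX hZ) hY)).sub
      (hi (contMDiffAt_mlieBracket hY hZ) hX)
  refine hk.congr_of_eventuallyEq ?_
  filter_upwards [ContMDiffAt.eventually_mdifferentiableAt_section hX,
    ContMDiffAt.eventually_mdifferentiableAt_section hY,
    ContMDiffAt.eventually_mdifferentiableAt_section hZ] with y h1 h2 h3
  exact inner_leviCivitaFun h1 h2 h3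

end Smoothness

/-! ### The Lie bracket as a commutator of derivations. -/

section LieBracket

variable {E : Type*} [NormedAddCommGroup E] [NormedSpace ℝ E] [FiniteDimensional ℝ E]
  {M : Type*} [TopologicalSpace M] [ChartedSpace E M] [IsManifold 𝓘(ℝ, E) ∞ M]
  {X Y : Π q : M, TangentSpace 𝓘(ℝ, E) q} {p : M}

/-- The Lie bracket of vector fields is the commutator of the derivations. -/
theorem mvfderiv_mlieBracket {g : M → ℝ} (hX : CMDiffAt ∞ (T% X) p) (hY : CMDiffAt ∞ (T% Y) p)
    (hg : CMDiffAt ∞ g p) :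
    d% (fun q ↦ d% g q (Y q)) p (X p) - d% (fun q ↦ d% g q (X q)) p (Y p)
      = d% g p (mlieBracket 𝓘(ℝ, E) X Y p) := by
  have : IsManifold 𝓘(ℝ, E) (minSmoothness ℝ 2) M :=
    .of_le (n := ∞) (by simpa using ENat.LEInfty.out)
  have : IsManifold 𝓘(ℝ, E) (minSmoothness ℝ 3) M :=
    .of_le (n := ∞) (by simpa using ENat.LEInfty.out)
  have h2 : minSmoothness ℝ 2 ≤ (∞ : WithTop ℕ∞) := by simpa using ENat.LEInfty.out
  have hd {W : Π q : M, TangentSpace 𝓘(ℝ, E) q} (hW : CMDiffAt ∞ (T% W) p) : MDiffAt (T% W) p :=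
    hW.mdifferentiableAt (by simp)
  have bracket {A Z : Π q : M, TangentSpace 𝓘(ℝ, E) q} (hA : CMDiffAt ∞ (T% A) p)
      (hZ : CMDiffAt ∞ (T% Z) p) : ∀ᶠ q in 𝓝 p, mlieBracket 𝓘(ℝ, E) A (g • Z) q
        = ((fun q ↦ d% g q (A q)) • Z + g • mlieBracket 𝓘(ℝ, E) A Z) q := by
    filter_upwards [ContMDiffAt.eventually_mdifferentiableAt_section hA,
      ContMDiffAt.eventually_mdifferentiableAt_section hZ,
      ContMDiffAt.eventually_mdifferentiableAt hg] with q h1 h2 h3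
    exact mlieBracket_smul_right h3 h2
  have hdg {A : Π q : M, TangentSpace 𝓘(ℝ, E) q} (hA : CMDiffAt ∞ (T% A) p) :
      MDiffAt (fun q ↦ d% g q (A q)) p :=
    (contMDiffAt_mvfderiv_apply hg hA).mdifferentiableAt (by simp)
  have hgd : MDiffAt g p := hg.mdifferentiableAt (by simp)
  have second {A B Z : Π q : M, TangentSpace 𝓘(ℝ, E) q} (hA : CMDiffAt ∞ (T% A) p)
      (hB : CMDiffAt ∞ (T% B) p) (hZ : CMDiffAt ∞ (T% Z) p) :
      mlieBracket 𝓘(ℝ, E) A (mlieBracket 𝓘(ℝ, E) B (g • Z)) p =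
        d% (fun q ↦ d% g q (B q)) p (A p) • Z p + d% g p (B p) • mlieBracket 𝓘(ℝ, E) A Z p
        + (d% g p (A p) • mlieBracket 𝓘(ℝ, E) B Z p
          + g p • mlieBracket 𝓘(ℝ, E) A (mlieBracket 𝓘(ℝ, E) B Z) p) := by
    rw [Filter.EventuallyEq.mlieBracket_vectorField_eq (V₁ := A) (V := A) .rfl (bracket hB hZ),
      mlieBracket_add_right ((hdg hB).smul_section (hd hZ))
        (hgd.smul_section (hd (contMDiffAt_mlieBracket hB hZ))),
      mlieBracket_smul_right (hdg hB) (hd hZ),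
      mlieBracket_smul_right hgd (hd (contMDiffAt_mlieBracket hB hZ))]
  -- Compare the Jacobi identity for X, Y, gZ with g times the one for X, Y, Z. The cross terms
  -- cancel, and what remains is X(Yg) - Y(Xg) - [X,Y]g times Z, where Z p = v is arbitrary.
  have key (v : TangentSpace 𝓘(ℝ, E) p) :
      (d% (fun q ↦ d% g q (Y q)) p (X p) - d% (fun q ↦ d% g q (X q)) p (Y p)
        - d% g p (mlieBracket 𝓘(ℝ, E) X Y p)) • v = 0 := by
    have hZ : CMDiffAt ∞ (T% (extend E v)) p := contMDiffAt_extend 𝓘(ℝ, E) E v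
    have hgZ : CMDiffAt ∞ (T% (g • extend E v)) p := hg.smul_section hZ
    have h1 := leibniz_identity_mlieBracket_apply (hX.of_le h2) (hY.of_le h2) (hgZ.of_le h2)
    have h2 := leibniz_identity_mlieBracket_apply (hX.of_le h2) (hY.of_le h2) (hZ.of_le h2)
    rw [second hX hY hZ, second hY hX hZ,
      mlieBracket_smul_right hgd (hd hZ), h2] at h1
    simp only [extend_apply_self] at h1
    rw [← sub_eq_zero] at h1
    refine Eq.trans ?_ h1
    module
  -- A nonzero v exists unless E = 0, in which case all the derivatives are taken along zero
  -- vectors.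
  rcases subsingleton_or_nontrivial E with hE | hE
  · have h0 (v : TangentSpace 𝓘(ℝ, E) p) : v = 0 := @Subsingleton.elim E hE v 0
    rw [h0 (X p), h0 (Y p), h0 (mlieBracket 𝓘(ℝ, E) X Y p)]
    simp
  · obtain ⟨v, hv⟩ := exists_ne (0 : E)
    have h1 := (smul_eq_zero.1 (key v)).resolve_right hv
    linarith

/-- Continuous linear functionals separate the points of G, which reduces this to real functions. It
is applied to charts. -/
theorem mvfderiv_mlieBracket_vector {G : Type*} [NormedAddCommGroup G] [NormedSpace ℝ G] {g : M → G}
    (hX : CMDiffAt ∞ (T% X) p) (hY : CMDiffAt ∞ (T% Y) p) (hg : CMDiffAt ∞ g p) :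
    d% (fun q ↦ d% g q (Y q)) p (X p) - d% (fun q ↦ d% g q (X q)) p (Y p)
      = d% g p (mlieBracket 𝓘(ℝ, E) X Y p) := by
  have hcomp (ℓ : StrongDual ℝ G) {f : M → G} {q : M} (hf : MDiffAt f q)
      (u : TangentSpace 𝓘(ℝ, E) q) : d% (fun q ↦ ℓ (f q)) q u = ℓ (d% f q u) := by
    have h := mfderiv_comp_apply (I := 𝓘(ℝ, E)) (I' := 𝓘(ℝ, G)) (I'' := 𝓘(ℝ, ℝ)) (g := ℓ) (f := f)
      q ℓ.mdifferentiableAt hf u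
    rw [ℓ.mfderiv_eq] at h
    exact h
  refine (SeparatingDual.eq_iff_forall_dual_eq (R := ℝ)).2 fun ℓ ↦ ?_
  have hℓ : CMDiffAt ∞ (fun q ↦ ℓ (g q)) p := ℓ.contMDiff.contMDiffAt.comp p hg
  have hgd := hg.mdifferentiableAt (by simp)
  have h1 := mvfderiv_mlieBracket hX hY hℓ
  have h3 {A : Π q : M, TangentSpace 𝓘(ℝ, E) q} (hA : CMDiffAt ∞ (T% A) p) :
      d% (fun q ↦ d% (fun q ↦ ℓ (g q)) q (A q)) p = d% (fun q ↦ ℓ (d% g q (A q))) p :=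
    mvfderiv_congr ((ContMDiffAt.eventually_mdifferentiableAt hg).mono fun q hq ↦ hcomp ℓ hq (A q))
  rw [h3 hX, h3 hY, hcomp ℓ ((contMDiffAt_mvfderiv_apply hg hX).mdifferentiableAt (by simp)),
    hcomp ℓ ((contMDiffAt_mvfderiv_apply hg hY).mdifferentiableAt (by simp)), hcomp ℓ hgd] at h1
  rw [map_sub, h1]

end LieBracket

/-! ### Covariant differentiation along a map: metric, Kähler structure, smoothness. -/

section CovDerivAlong

variable {E : Type*} [NormedAddCommGroup E] [NormedSpace ℝ E]
  {M : Type*} [TopologicalSpace M] [ChartedSpace E M]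
  {E' : Type*} [NormedAddCommGroup E'] [NormedSpace ℝ E']
  {N : Type*} [TopologicalSpace N] [ChartedSpace E' N] [IsManifold 𝓘(ℝ, E') ∞ N]
  [RiemannianBundle (fun x : N ↦ TangentSpace 𝓘(ℝ, E') x)]
  [IsContMDiffRiemannianBundle 𝓘(ℝ, E') ∞ E' (fun x : N ↦ TangentSpace 𝓘(ℝ, E') x)]
  {F : C^∞⟮𝓘(ℝ, E), M; 𝓘(ℝ, E'), N⟯} {p : M}
  {V W : Π q : M, TangentSpace 𝓘(ℝ, E') (F q)} {f : M → ℝ}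

theorem SmoothAlongAt.inner (hV : SmoothAlongAt F V p) (hW : SmoothAlongAt F W p) :
    CMDiffAt ∞ (fun q ↦ inner ℝ (V q) (W q)) p :=
  contMDiffAt_inner_bundle hV hW

theorem MDiffAlongAt.inner (hV : MDiffAlongAt F V p) (hW : MDiffAlongAt F W p) :
    MDiffAt (fun q ↦ inner ℝ (V q) (W q)) p :=
  mdifferentiableAt_inner_bundle_comp hV hW

variable [FiniteDimensional ℝ E']

/-- Covariant differentiation along `F` is compatible with the metric of `N`. -/
theorem mvfderiv_inner_along (hV : MDiffAlongAt F V p) (hW : MDiffAlongAt F W p)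
    (u : TangentSpace 𝓘(ℝ, E) p) :
    d% (fun q ↦ inner ℝ (V q) (W q)) p u =
      inner ℝ (covDerivAlong F V p u) (W p) + inner ℝ (V p) (covDerivAlong F W p u) := by
  -- Both sides obey the same sum and product rules in V and in W. Two nested inductions leave
  -- restrictions of fields S, T of N, where the chain rule reduces the claim to
  -- `leviCivita_metric`.
  refine hV.induction (Q := fun V ↦ d% (fun q ↦ inner ℝ (V q) (W q)) p u =
      inner ℝ (covDerivAlong F V p u) (W p) + inner ℝ (V p) (covDerivAlong F W p u)) ?_ ?_ ?_ ?_
  · intro V V' _ h hQ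
    have h1 : d% (fun q ↦ inner ℝ (V' q) (W q)) p = d% (fun q ↦ inner ℝ (V q) (W q)) p :=
      mvfderiv_congr (h.mono fun q hq ↦ by simp only [hq])
    rw [← covDerivAlong_congr h, ← h.self_of_nhds, ← hQ, h1]
  · intro V V' hV hV' hQ hQ'
    simp only [inner_add_left]
    rw [mvfderiv_fun_add (hV.inner hW) (hV'.inner hW), covDerivAlong_add hV hV', add_apply,
      add_apply, inner_add_left, hQ, hQ']
    ring
  · intro f V hf hV hQ
    simp only [real_inner_smul_left]
    rw [mvfderiv_fun_mul hf (hV.inner hW), covDerivAlong_smul hf hV, inner_add_left,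
      real_inner_smul_left, real_inner_smul_left, add_apply, smul_apply, smul_apply, hQ]
    simp only [smul_eq_mul]
    ring
  intro S hS
  have hSd := hS.mdifferentiableAt (by simp)
  have hSF := MDiffAlongAt.comp (F := F) hSd
  refine hW.induction (Q := fun W ↦ d% (fun q ↦ inner ℝ (S (F q)) (W q)) p u =
      inner ℝ (covDerivAlong F (fun q ↦ S (F q)) p u) (W p)
        + inner ℝ (S (F p)) (covDerivAlong F W p u)) ?_ ?_ ?_ ?_
  · intro V V' _ h hQ
    have h1 : d% (fun q ↦ inner ℝ (S (F q)) (V' q)) p = d% (fun q ↦ inner ℝ (S (F q)) (V q)) p :=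
      mvfderiv_congr (h.mono fun q hq ↦ by simp only [hq])
    rw [← covDerivAlong_congr h, ← h.self_of_nhds, ← hQ, h1]
  · intro V V' hV hV' hQ hQ'
    simp only [inner_add_right]
    rw [mvfderiv_fun_add (hSF.inner hV) (hSF.inner hV'), covDerivAlong_add hV hV', add_apply,
      add_apply, inner_add_right, hQ, hQ']
    ring
  · intro f V hf hV hQ
    simp only [real_inner_smul_right]
    rw [mvfderiv_fun_mul hf (hSF.inner hV), covDerivAlong_smul hf hV, inner_add_right,
      real_inner_smul_right, real_inner_smul_right, add_apply, smul_apply, smul_apply, hQ]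
    simp only [smul_eq_mul]
    ring
  · intro T hT
    have hTd := hT.mdifferentiableAt (by simp)
    rw [covDerivAlong_comp hSd, covDerivAlong_comp hTd]
    have h1 : d% (fun q ↦ inner ℝ (S (F q)) (T (F q))) p u
        = d% (fun y ↦ inner ℝ (S y) (T y)) (F p) (differential F p u) :=
      mvfderiv_comp_apply (g := fun y ↦ inner ℝ (S y) (T y)) p (mdifferentiableAt_inner hSd hTd)
        (F.contMDiff.mdifferentiableAt (by simp)) u
    have h2 := leviCivita_metric
      (mdifferentiableAt_extend 𝓘(ℝ, E') E' (differential F p u)) hSd hTd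
    simp only [extend_apply_self] at h2
    rw [h1, h2]

variable {J : Π x : N, TangentSpace 𝓘(ℝ, E') x →L[ℝ] TangentSpace 𝓘(ℝ, E') x}

theorem SmoothAlongAt.kaehler (hJ : IsKaehler J) (hV : SmoothAlongAt F V p) :
    SmoothAlongAt F (fun q ↦ J (F q) (V q)) p :=
  ContMDiffAt.clm_bundle_apply (hJ.smooth.contMDiffAt.comp p F.contMDiff.contMDiffAt) hV

theorem MDiffAlongAt.kaehler (hJ : IsKaehler J) (hV : MDiffAlongAt F V p) :
    MDiffAlongAt F (fun q ↦ J (F q) (V q)) p :=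
  MDifferentiableAt.clm_bundle_apply
    ((hJ.smooth.contMDiffAt.mdifferentiableAt (by simp)).comp p
      (F.contMDiff.mdifferentiableAt (by simp))) hV

theorem contMDiffAt_kaehler (hJ : IsKaehler J) {S : Π x : N, TangentSpace 𝓘(ℝ, E') x} {x : N}
    (hS : CMDiffAt ∞ (T% S) x) : CMDiffAt ∞ (T% (fun y ↦ J y (S y))) x :=
  ContMDiffAt.clm_bundle_apply (b := id) hJ.smooth.contMDiffAt hS

/-- A Kähler structure commutes with covariant differentiation along `F`. -/
theorem covDerivAlong_kaehler (hJ : IsKaehler J) (hV : MDiffAlongAt F V p)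
    (u : TangentSpace 𝓘(ℝ, E) p) :
    covDerivAlong F (fun q ↦ J (F q) (V q)) p u = J (F p) (covDerivAlong F V p u) := by
  -- The hypothesis `parallel` speaks of smooth fields of N only; the induction ends in such fields
  -- and so covers every differentiable V.
  refine hV.induction (Q := fun V ↦ covDerivAlong F (fun q ↦ J (F q) (V q)) p u
    = J (F p) (covDerivAlong F V p u)) ?_ ?_ ?_ ?_
  · intro V V' _ h hQ
    rw [← covDerivAlong_congr h, ← hQ]
    rw [covDerivAlong_congr (V := fun q ↦ J (F q) (V q)) (h.mono fun q hq ↦ by rw [hq])]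
  · intro V V' hV hV' hQ hQ'
    simp only [map_add]
    rw [covDerivAlong_add (hV.kaehler hJ) (hV'.kaehler hJ), covDerivAlong_add hV hV', add_apply,
      add_apply, hQ, hQ', map_add]
  · intro f V hf hV hQ
    simp only [map_smul]
    rw [covDerivAlong_smul hf (hV.kaehler hJ), covDerivAlong_smul hf hV, hQ, map_add, map_smul,
      map_smul]
  · intro S hS
    rw [covDerivAlong_comp (S := fun y ↦ J y (S y))
      ((contMDiffAt_kaehler hJ hS).mdifferentiableAt (by simp)),
      covDerivAlong_comp (hS.mdifferentiableAt (by simp)), hJ.parallel _ _ _ hS]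

/-- The Levi-Civita connection of `N` in the direction of a smooth vector field along `F`. -/
theorem SmoothAlongAt.leviCivita {S : Π x : N, TangentSpace 𝓘(ℝ, E') x}
    (hS : CMDiffAt ∞ (T% S) (F p)) (hV : SmoothAlongAt F V p) :
    SmoothAlongAt F (fun q ↦ leviCivita S (F q) (V q)) p := by
  refine hV.induction (Q := fun V ↦ SmoothAlongAt F (fun q ↦ TotallyReal.leviCivita S (F q) (V q)) p)
    ?_ ?_ ?_ ?_
  · intro V W _ h hQ
    exact hQ.congr (h.mono fun q hq ↦ by rw [hq])
  · intro V W _ _ h1 h2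
    simpa only [map_add] using h1.add h2
  · intro f V hf _ h1
    simpa only [map_smul] using h1.smul hf
  · intro T hT
    exact SmoothAlongAt.comp (contMDiffAt_leviCivita hT hS)

variable [IsManifold 𝓘(ℝ, E) ∞ M] {X Y : Π q : M, TangentSpace 𝓘(ℝ, E) q}

/-- Covariant derivatives of smooth vector fields along `F` are smooth. -/
theorem SmoothAlongAt.covDerivAlong (hX : CMDiffAt ∞ (T% X) p) (hV : SmoothAlongAt F V p) :
    SmoothAlongAt F (fun q ↦ covDerivAlong F V q (X q)) p := by
  refine hV.induction (Q := fun V ↦ SmoothAlongAt F (fun q ↦ TotallyReal.covDerivAlong F V q (X q)) p)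
    ?_ ?_ ?_ ?_
  · intro V W _ h hQ
    exact hQ.congr (h.eventually_nhds.mono fun q hq ↦ by rw [covDerivAlong_congr hq])
  · intro V W hV hW h1 h2
    refine (h1.add h2).congr ?_
    filter_upwards [hV.eventually_mdiffAlongAt, hW.eventually_mdiffAlongAt] with q hq1 hq2
    rw [covDerivAlong_add hq1 hq2, add_apply]
  · intro f V hf hV h1
    refine ((hV.smul (contMDiffAt_mvfderiv_apply hf hX)).add (h1.smul hf)).congr ?_
    filter_upwards [hV.eventually_mdiffAlongAt, ContMDiffAt.eventually_mdifferentiableAt hf]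
      with q hq1 hq2
    rw [covDerivAlong_smul hq2 hq1]
  · intro S hS
    refine (SmoothAlongAt.leviCivita hS (SmoothAlongAt.differential hX)).congr ?_
    filter_upwards [F.contMDiff.continuous.continuousAt.eventually
      (ContMDiffAt.eventually_mdifferentiableAt_section hS)] with q hq
    exact (covDerivAlong_comp hq _).symm

end CovDerivAlong

/-! ### Torsion of covariant differentiation along a map. -/

section Torsion

variable {E : Type*} [NormedAddCommGroup E] [NormedSpace ℝ E]
  {M : Type*} [TopologicalSpace M] [ChartedSpace E M] [IsManifold 𝓘(ℝ, E) ∞ M] [FiniteDimensional ℝ E]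
  {E' : Type*} [NormedAddCommGroup E'] [NormedSpace ℝ E']
  {N : Type*} [TopologicalSpace N] [ChartedSpace E' N] [IsManifold 𝓘(ℝ, E') ∞ N]
  {F : C^∞⟮𝓘(ℝ, E), M; 𝓘(ℝ, E'), N⟯} {p : M} {X Y : Π q : M, TangentSpace 𝓘(ℝ, E) q}

/-- Coordinates in the tangent bundle are derivatives of the chart. Derivatives of coordinates thus
become second derivatives of a function, to which the commutator formula for the bracket applies. -/
theorem eventually_trivializationAt_eq_mvfderiv (x : N) :
    ∀ᶠ y in 𝓝 x, ∀ v : TangentSpace 𝓘(ℝ, E') y,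
      (trivializationAt E' (fun x : N ↦ TangentSpace 𝓘(ℝ, E') x) x ⟨y, v⟩).2
        = d% (extChartAt 𝓘(ℝ, E') x) y v := by
  filter_upwards [eventually_mem_baseSet_trivializationAt (E' := E') x] with y hy v
  rw [← Trivialization.continuousLinearMapAt_apply_of_mem ℝ _ hy]
  exact congrArg (fun L ↦ L v)
    (TangentBundle.continuousLinearMapAt_trivializationAt (I := 𝓘(ℝ, E')) (x₀ := x) (x := y) hy)

variable [FiniteDimensional ℝ E']

/-- Fields with constant coordinates commute: their derivatives of the chart are constant near x, so
the chart has zero derivative along the bracket, and the differential of a chart is injective. -/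
theorem mlieBracket_extend {x : N} (v w : TangentSpace 𝓘(ℝ, E') x) :
    mlieBracket 𝓘(ℝ, E') (extend E' v) (extend E' w) x = 0 := by
  set t := trivializationAt E' (fun x : N ↦ TangentSpace 𝓘(ℝ, E') x) x
  have hx : x ∈ t.baseSet := mem_baseSet_trivializationAt' x
  have hφ := eventually_trivializationAt_eq_mvfderiv (E' := E') x
  have h1 := mvfderiv_mlieBracket_vector (contMDiffAt_extend 𝓘(ℝ, E') E' v)
    (contMDiffAt_extend 𝓘(ℝ, E') E' w) (contMDiffAt_extChartAt (I := 𝓘(ℝ, E')) (x := x) (n := ∞))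
  have h2 (w : TangentSpace 𝓘(ℝ, E') x) :
      d% (fun y ↦ d% (extChartAt 𝓘(ℝ, E') x) y (extend E' w y)) x = 0 := by
    rw [← mvfderiv_const (I := 𝓘(ℝ, E')) (t ⟨x, w⟩).2 (x := x)]
    refine mvfderiv_congr ?_
    filter_upwards [hφ, eventually_mem_baseSet_trivializationAt (E' := E') x] with y hy hyt
    rw [← hy]
    change (t ⟨y, t.symm y (t ⟨x, w⟩).2⟩).2 = _
    rw [t.apply_mk_symm hyt]
  rw [h2, h2, ← hφ.self_of_nhds, ← Trivialization.continuousLinearMapAt_apply_of_mem ℝ _ hx] at h1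
  rw [← t.symmL_continuousLinearMapAt (R := ℝ) hx (mlieBracket _ _ _ x), ← h1]
  simp

variable [RiemannianBundle (fun x : N ↦ TangentSpace 𝓘(ℝ, E') x)]
  [IsContMDiffRiemannianBundle 𝓘(ℝ, E') ∞ E' (fun x : N ↦ TangentSpace 𝓘(ℝ, E') x)]

/-- Covariant differentiation along `F` is torsion free. -/
theorem covDerivAlong_torsion (hX : CMDiffAt ∞ (T% X) p) (hY : CMDiffAt ∞ (T% Y) p) :
    covDerivAlong F (fun q ↦ differential F q (Y q)) p (X p)
      - covDerivAlong F (fun q ↦ differential F q (X q)) p (Y p)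
      = differential F p (mlieBracket 𝓘(ℝ, E) X Y p) := by
  set t := trivializationAt E' (fun x : N ↦ TangentSpace 𝓘(ℝ, E') x) (F p)
  have hx : F p ∈ t.baseSet := mem_baseSet_trivializationAt' (F p)
  set φ := extChartAt 𝓘(ℝ, E') (F p)
  have hφ : CMDiffAt ∞ φ (F p) := contMDiffAt_extChartAt
  have hφF : CMDiffAt ∞ (fun q ↦ φ (F q)) p := hφ.comp p F.contMDiff.contMDiffAt
  have hcoord : ∀ᶠ q in 𝓝 p, ∀ u : TangentSpace 𝓘(ℝ, E) q,
      (t ⟨F q, differential F q u⟩).2 = d% (fun q ↦ φ (F q)) q u := by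
    have hc := F.contMDiff.continuous.continuousAt (x := p)
    filter_upwards [hc.eventually (eventually_trivializationAt_eq_mvfderiv (E' := E') (F p)),
      hc.eventually (ContMDiffAt.eventually_mdifferentiableAt hφ)] with q hq hq' u
    rw [hq]
    exact (mfderiv_comp_apply q hq' (F.contMDiff.mdifferentiableAt (by simp)) u).symm
  have h1 (Z : Π q : M, TangentSpace 𝓘(ℝ, E) q) :
      d% (coordAlong F p fun q ↦ differential F q (Z q)) p
        = d% (fun q ↦ d% (fun q ↦ φ (F q)) q (Z q)) p :=
    mvfderiv_congr (hcoord.mono fun q hq ↦ hq (Z q))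
  -- The connection terms of the two covariant derivatives agree, since the two constant-coordinate
  -- extensions commute. What remains is the commutator of second derivatives of φ ∘ F.
  have h2 := leviCivita_torsion
    (mdifferentiableAt_extend 𝓘(ℝ, E') E' (differential F p (X p)))
    (mdifferentiableAt_extend 𝓘(ℝ, E') E' (differential F p (Y p)))
  rw [mlieBracket_extend, extend_apply_self, extend_apply_self, sub_eq_zero] at h2
  have h3 := hcoord.self_of_nhds (mlieBracket 𝓘(ℝ, E) X Y p)
  rw [covDerivAlong_apply, covDerivAlong_apply, h1, h1, h2, add_sub_add_right_eq_sub, ← map_sub,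
    mvfderiv_mlieBracket_vector hX hY hφF, ← h3,
    ← Trivialization.continuousLinearMapAt_apply_of_mem ℝ _ hx]
  exact t.symmL_continuousLinearMapAt hx _

end Torsion

/-! ### The curvature of the pulled back connection -/

section Curvature

variable {E : Type*} [NormedAddCommGroup E] [NormedSpace ℝ E]
  {M : Type*} [TopologicalSpace M] [ChartedSpace E M]
  {E' : Type*} [NormedAddCommGroup E'] [NormedSpace ℝ E'] [FiniteDimensional ℝ E']
  {N : Type*} [TopologicalSpace N] [ChartedSpace E' N] [IsManifold 𝓘(ℝ, E') ∞ N]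
  [RiemannianBundle (fun x : N ↦ TangentSpace 𝓘(ℝ, E') x)]
  [IsContMDiffRiemannianBundle 𝓘(ℝ, E') ∞ E' (fun x : N ↦ TangentSpace 𝓘(ℝ, E') x)]
  {F : C^∞⟮𝓘(ℝ, E), M; 𝓘(ℝ, E'), N⟯} {p : M} {X Y : Π q : M, TangentSpace 𝓘(ℝ, E) q}
  {V W : Π q : M, TangentSpace 𝓘(ℝ, E') (F q)} {f : M → ℝ}

/-- The curvature of covariant differentiation along `F`. -/
def curvatureAlong (F : C^∞⟮𝓘(ℝ, E), M; 𝓘(ℝ, E'), N⟯) (X Y : Π q : M, TangentSpace 𝓘(ℝ, E) q)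
    (V : Π q : M, TangentSpace 𝓘(ℝ, E') (F q)) (p : M) : TangentSpace 𝓘(ℝ, E') (F p) :=
  covDerivAlong F (fun q ↦ covDerivAlong F V q (Y q)) p (X p)
    - covDerivAlong F (fun q ↦ covDerivAlong F V q (X q)) p (Y p)
    - covDerivAlong F V p (mlieBracket 𝓘(ℝ, E) X Y p)

theorem covDerivAlong_zero (u : TangentSpace 𝓘(ℝ, E) p) :
    covDerivAlong F (fun _ ↦ 0) p u = 0 := by
  have h0 : MDiffAlongAt F (fun _ ↦ 0) p := MDiffAlongAt.comp (S := 0)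
    ((contMDiff_zeroSection (n := ∞) ℝ
      (fun x : N ↦ TangentSpace 𝓘(ℝ, E') x)).contMDiffAt.mdifferentiableAt (by simp))
  have h := congrArg (· u) (covDerivAlong_add h0 h0)
  simp only [add_zero, add_apply] at h
  exact left_eq_add.1 h

theorem curvatureAlong_congr (h : ∀ᶠ q in 𝓝 p, V q = W q) :
    curvatureAlong F X Y V p = curvatureAlong F X Y W p := by
  have h1 (Z : Π q : M, TangentSpace 𝓘(ℝ, E) q) :
      ∀ᶠ q in 𝓝 p, covDerivAlong F V q (Z q) = covDerivAlong F W q (Z q) :=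
    h.eventually_nhds.mono fun q hq ↦ by rw [covDerivAlong_congr hq]
  rw [curvatureAlong, curvatureAlong, covDerivAlong_congr (h1 X), covDerivAlong_congr (h1 Y),
    covDerivAlong_congr h]

theorem curvatureAlong_zero : curvatureAlong F X Y (fun _ ↦ 0) p = 0 := by
  simp only [curvatureAlong, covDerivAlong_zero, sub_zero]

theorem covDerivAlong_eq_sum {ι : Type*} [Fintype ι] {T : ι → Π x : N, TangentSpace 𝓘(ℝ, E') x}
    {c : ι → M → ℝ} (hT : ∀ i, MDiffAt (T% (T i)) (F p)) (hc : ∀ i, MDiffAt (c i) p)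
    (hV : ∀ᶠ q in 𝓝 p, V q = ∑ i, c i q • T i (F q)) (u : TangentSpace 𝓘(ℝ, E) p) :
    covDerivAlong F V p u = ∑ i, (d% (c i) p u • T i (F p)
      + c i p • leviCivita (T i) (F p) (differential F p u)) := by
  classical
  rw [covDerivAlong_congr hV]
  have key : ∀ s : Finset ι, MDiffAlongAt F (fun q ↦ ∑ i ∈ s, c i q • T i (F q)) p ∧
      covDerivAlong F (fun q ↦ ∑ i ∈ s, c i q • T i (F q)) p u = ∑ i ∈ s, (d% (c i) p u • T i (F p)
      + c i p • leviCivita (T i) (F p) (differential F p u)) := by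
    intro s
    induction s using Finset.induction_on with
    | empty =>
      simp only [Finset.sum_empty]
      exact ⟨MDiffAlongAt.comp (S := 0) ((contMDiff_zeroSection (n := ∞) ℝ
        (fun x : N ↦ TangentSpace 𝓘(ℝ, E') x)).contMDiffAt.mdifferentiableAt (by simp)),
        covDerivAlong_zero u⟩
    | insert a s ha ih =>
      simp only [Finset.sum_insert ha]
      have h1 := MDiffAlongAt.comp (hT a)
      refine ⟨(h1.smul (hc a)).add ih.1, ?_⟩
      rw [covDerivAlong_add (h1.smul (hc a)) ih.1, add_apply, ih.2, covDerivAlong_smul (hc a) h1,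
        covDerivAlong_comp (hT a)]
  exact (key Finset.univ).2

/-- The curvature tensor of `N` at `x`. -/
def curvatureTensor (x : N) : TangentSpace 𝓘(ℝ, E') x →ₗ[ℝ] TangentSpace 𝓘(ℝ, E') x →ₗ[ℝ]
    TangentSpace 𝓘(ℝ, E') x →ₗ[ℝ] TangentSpace 𝓘(ℝ, E') x :=
  letI κ (a : Fin (finrank ℝ E')) : TangentSpace 𝓘(ℝ, E') x →ₗ[ℝ] ℝ :=
    (finBasis ℝ E').coord a ∘ₗ ((trivializationAt E' (fun x : N ↦ TangentSpace 𝓘(ℝ, E') x)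
      x).continuousLinearMapAt ℝ x).toLinearMap
  ∑ a, ∑ b, ∑ c, (κ a).smulRight ((κ b).smulRight ((κ c).smulRight
    (curvature (coordFrame x a) (coordFrame x b) (coordFrame x c) x)))

/-- `curvatureTensor` is trilinear by construction from its values on the coordinate frame; that it
computes the curvature of arbitrary smooth fields is shown in `curvature_eq_curvatureTensor`. -/
theorem curvatureTensor_apply (U V W : Π q : M, TangentSpace 𝓘(ℝ, E') (F q)) :
    curvatureTensor (F p) (U p) (V p) (W p) = ∑ a, ∑ b, ∑ c, coeffAlong F p U a p •
      coeffAlong F p V b p • coeffAlong F p W c p •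
        curvature (coordFrame (F p) a) (coordFrame (F p) b) (coordFrame (F p) c) (F p) := by
  have h (V : Π q : M, TangentSpace 𝓘(ℝ, E') (F q)) :
      (trivializationAt E' (fun x : N ↦ TangentSpace 𝓘(ℝ, E') x) (F p)).continuousLinearMapAt ℝ
        (F p) (V p) = coordAlong F p V p :=
    Trivialization.continuousLinearMapAt_apply_of_mem ℝ _ (mem_baseSet_trivializationAt' (F p)) _
  simp only [curvatureTensor, LinearMap.sum_apply, LinearMap.smulRight_apply, LinearMap.smul_apply,
    LinearMap.comp_apply, ContinuousLinearMap.coe_coe, h]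
  rfl

variable [IsManifold 𝓘(ℝ, E) ∞ M]

theorem curvatureAlong_add (hX : CMDiffAt ∞ (T% X) p) (hY : CMDiffAt ∞ (T% Y) p)
    (hV : SmoothAlongAt F V p) (hW : SmoothAlongAt F W p) :
    curvatureAlong F X Y (fun q ↦ V q + W q) p
      = curvatureAlong F X Y V p + curvatureAlong F X Y W p := by
  have h1 (Z : Π q : M, TangentSpace 𝓘(ℝ, E) q) : ∀ᶠ q in 𝓝 p,
      covDerivAlong F (fun q ↦ V q + W q) q (Z q)
        = covDerivAlong F V q (Z q) + covDerivAlong F W q (Z q) := by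
    filter_upwards [hV.eventually_mdiffAlongAt, hW.eventually_mdiffAlongAt] with q hq1 hq2
    rw [covDerivAlong_add hq1 hq2, add_apply]
  simp only [curvatureAlong]
  rw [covDerivAlong_congr (h1 X), covDerivAlong_congr (h1 Y),
    covDerivAlong_add (hV.covDerivAlong hX).mdiffAlongAt (hW.covDerivAlong hX).mdiffAlongAt,
    covDerivAlong_add (hV.covDerivAlong hY).mdiffAlongAt (hW.covDerivAlong hY).mdiffAlongAt,
    covDerivAlong_add hV.mdiffAlongAt hW.mdiffAlongAt, add_apply, add_apply, add_apply]
  abel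

variable [FiniteDimensional ℝ E]

/-- The mixed first-order terms are symmetric in X and Y, and the second derivatives of f cancel
because X(Yf) - Y(Xf) = [X,Y]f. -/
theorem curvatureAlong_smul (hX : CMDiffAt ∞ (T% X) p) (hY : CMDiffAt ∞ (T% Y) p)
    (hf : CMDiffAt ∞ f p) (hV : SmoothAlongAt F V p) :
    curvatureAlong F X Y (fun q ↦ f q • V q) p = f p • curvatureAlong F X Y V p := by
  have h1 (Z : Π q : M, TangentSpace 𝓘(ℝ, E) q) : ∀ᶠ q in 𝓝 p,
      covDerivAlong F (fun q ↦ f q • V q) q (Z q)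
        = d% f q (Z q) • V q + f q • covDerivAlong F V q (Z q) := by
    filter_upwards [hV.eventually_mdiffAlongAt, ContMDiffAt.eventually_mdifferentiableAt hf]
      with q hq1 hq2
    rw [covDerivAlong_smul hq2 hq1]
  have hfd := hf.mdifferentiableAt (by simp)
  have h2 {Z : Π q : M, TangentSpace 𝓘(ℝ, E) q} (hZ : CMDiffAt ∞ (T% Z) p)
      (u : TangentSpace 𝓘(ℝ, E) p) :
      covDerivAlong F (fun q ↦ covDerivAlong F (fun q ↦ f q • V q) q (Z q)) p u
      = d% (fun q ↦ d% f q (Z q)) p u • V p + d% f p (Z p) • covDerivAlong F V p u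
        + (d% f p u • covDerivAlong F V p (Z p)
          + f p • covDerivAlong F (fun q ↦ covDerivAlong F V q (Z q)) p u) := by
    have hfZ := contMDiffAt_mvfderiv_apply hf hZ
    rw [covDerivAlong_congr (h1 Z), covDerivAlong_add (hV.smul hfZ).mdiffAlongAt
      ((hV.covDerivAlong hZ).smul hf).mdiffAlongAt, add_apply,
      covDerivAlong_smul (hfZ.mdifferentiableAt (by simp)) hV.mdiffAlongAt,
      covDerivAlong_smul hfd (hV.covDerivAlong hZ).mdiffAlongAt]
  have h3 := mvfderiv_mlieBracket hX hY hf
  rw [curvatureAlong, h2 hX, h2 hY, covDerivAlong_smul hfd hV.mdiffAlongAt, ← h3, curvatureAlong]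
  module

/-- The curvature of the restriction of a vector field of `N`. -/
theorem curvatureAlong_comp (hX : CMDiffAt ∞ (T% X) p) (hY : CMDiffAt ∞ (T% Y) p)
    {S : Π x : N, TangentSpace 𝓘(ℝ, E') x} (hS : CMDiffAt ∞ (T% S) (F p)) :
    curvatureAlong F X Y (fun q ↦ S (F q)) p =
      ∑ a, ∑ b, coeffAlong F p (fun q ↦ differential F q (X q)) a p •
        coeffAlong F p (fun q ↦ differential F q (Y q)) b p •
          curvature (coordFrame (F p) a) (coordFrame (F p) b) S (F p) := by
  let e (a : Fin (finrank ℝ E')) := coordFrame (F p) a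
  have he (a) : CMDiffAt ∞ (T% (e a)) (F p) := contMDiffAt_coordFrame (F p) a
  have hed (a) : MDiffAt (T% (e a)) (F p) := (he a).mdifferentiableAt (by simp)
  let T (b) (y : N) := leviCivita S y (e b y)
  have hT (b) : MDiffAt (T% (T b)) (F p) :=
    (contMDiffAt_leviCivita (he b) hS).mdifferentiableAt (by simp)
  let c (Z : Π q : M, TangentSpace 𝓘(ℝ, E) q) := coeffAlong F p (fun q ↦ differential F q (Z q))
  have hsum (Z : Π q : M, TangentSpace 𝓘(ℝ, E) q) :
      differential F p (Z p) = ∑ a, c Z a p • e a (F p) :=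
    sum_coeffAlong fun q ↦ differential F q (Z q)
  have hSd : ∀ᶠ q in 𝓝 p, MDiffAt (T% S) (F q) :=
    F.contMDiff.continuous.continuousAt.eventually
      (ContMDiffAt.eventually_mdifferentiableAt_section hS)
  have first {Z : Π q : M, TangentSpace 𝓘(ℝ, E) q} (hZ : CMDiffAt ∞ (T% Z) p)
      (U : Π q : M, TangentSpace 𝓘(ℝ, E) q) :
      covDerivAlong F (fun q ↦ covDerivAlong F (fun q ↦ S (F q)) q (Z q)) p (U p) =
        ∑ b, d% (c Z b) p (U p) • T b (F p)
        + ∑ b, ∑ a, (c Z b p * c U a p) • leviCivita (T b) (F p) (e a (F p)) := by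
    rw [covDerivAlong_eq_sum (T := T) (c := c Z) hT
      (fun b ↦ mdifferentiableAt_coeffAlong (SmoothAlongAt.differential hZ).mdiffAlongAt b),
      Finset.sum_add_distrib, hsum U]
    · simp only [map_sum, map_smul, Finset.smul_sum, smul_smul]
    · filter_upwards [hSd, eventually_eq_sum_coordFrame F p fun q ↦ differential F q (Z q)]
        with q hq1 hq2
      rw [covDerivAlong_comp hq1, ← hq2]
      simp only [map_sum, map_smul]
      rfl
  have second {Z : Π q : M, TangentSpace 𝓘(ℝ, E) q} (hZ : CMDiffAt ∞ (T% Z) p)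
      (U : Π q : M, TangentSpace 𝓘(ℝ, E) q) :
      covDerivAlong F (fun q ↦ differential F q (Z q)) p (U p) =
        ∑ b, d% (c Z b) p (U p) • e b (F p)
        + ∑ b, ∑ a, (c Z b p * c U a p) • leviCivita (e b) (F p) (e a (F p)) := by
    rw [covDerivAlong_eq_sum (T := e) (c := c Z) hed
      (fun b ↦ mdifferentiableAt_coeffAlong (SmoothAlongAt.differential hZ).mdiffAlongAt b),
      Finset.sum_add_distrib, hsum U]
    · simp only [map_sum, map_smul, Finset.smul_sum, smul_smul]
    · exact (eventually_eq_sum_coordFrame F p _).mono fun q hq ↦ hq.symm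
  have hcurv (a b) : curvature (e a) (e b) S (F p) = leviCivita (T b) (F p) (e a (F p))
      - leviCivita (T a) (F p) (e b (F p))
      - (leviCivita S (F p) (leviCivita (e b) (F p) (e a (F p)))
        - leviCivita S (F p) (leviCivita (e a) (F p) (e b (F p)))) := by
    rw [← map_sub, leviCivita_torsion (hed a) (hed b)]
    rfl
  -- Torsion freeness replaces dF[X,Y] by covariant derivatives of dF X and dF Y. In the frame
  -- expansion the terms containing derivatives of the coefficients then cancel.
  rw [curvatureAlong, first hY X, first hX Y, covDerivAlong_comp (hS.mdifferentiableAt (by simp)),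
    ← covDerivAlong_torsion hX hY, second hY X, second hX Y]
  have hcomm (K : Fin (finrank ℝ E') → Fin (finrank ℝ E') → TangentSpace 𝓘(ℝ, E') (F p)) :
      ∑ b, ∑ a, (c Y b p * c X a p) • K b a = ∑ a, ∑ b, (c X a p * c Y b p) • K b a := by
    rw [Finset.sum_comm]
    simp only [mul_comm]
  have hrhs : (∑ a, ∑ b, c X a p • c Y b p • curvature (e a) (e b) S (F p)) =
      (∑ a, ∑ b, (c X a p * c Y b p) • leviCivita (T b) (F p) (e a (F p))
        - ∑ a, ∑ b, (c X a p * c Y b p) • leviCivita (T a) (F p) (e b (F p)))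
      - (∑ a, ∑ b, (c X a p * c Y b p) • leviCivita S (F p) (leviCivita (e b) (F p) (e a (F p)))
        - ∑ a, ∑ b, (c X a p * c Y b p) •
          leviCivita S (F p) (leviCivita (e a) (F p) (e b (F p)))) := by
    simp only [hcurv, smul_smul, smul_sub, Finset.sum_sub_distrib]
  change _ = ∑ a, ∑ b, c X a p • c Y b p • curvature (e a) (e b) S (F p)
  rw [hrhs, hcomm, hcomm]
  simp only [map_sub, map_add, map_sum, map_smul]
  change _ + _ - (_ + _) - (∑ b, d% (c Y b) p (X p) • T b (F p) + _
    - (∑ b, d% (c X b) p (Y p) • T b (F p) + _)) = _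
  abel

/-- The curvature of the pulled back connection is the pull back of the curvature. -/
theorem curvatureAlong_eq (hX : CMDiffAt ∞ (T% X) p) (hY : CMDiffAt ∞ (T% Y) p)
    (hV : SmoothAlongAt F V p) :
    curvatureAlong F X Y V p =
      curvatureTensor (F p) (differential F p (X p)) (differential F p (Y p)) (V p) := by
  -- Frame fields, rather than general fields of N, are the base case because `curvatureTensor` is
  -- given by its values on the frame.
  refine hV.induction_coordFrame (Q := fun V ↦ curvatureAlong F X Y V p =
      curvatureTensor (F p) (differential F p (X p)) (differential F p (Y p)) (V p)) ?_ ?_ ?_ ?_ ?_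
  · intro V W _ h hQ
    rw [← curvatureAlong_congr h, hQ, h.self_of_nhds]
  · rw [curvatureAlong_zero, map_zero]
  · intro V W hV hW h1 h2
    rw [curvatureAlong_add hX hY hV hW, h1, h2, map_add]
  · intro f V hf hV h1
    rw [curvatureAlong_smul hX hY hf hV, h1, map_smul]
  · intro c
    rw [curvatureAlong_comp hX hY (contMDiffAt_coordFrame (F p) c),
      curvatureTensor_apply (fun q ↦ differential F q (X q)) (fun q ↦ differential F q (Y q))
        (fun q ↦ coordFrame (F p) c (F q))]
    refine Finset.sum_congr rfl fun a _ ↦ Finset.sum_congr rfl fun b _ ↦ ?_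
    have h (c') : coeffAlong F p (fun q ↦ coordFrame (F p) c (F q)) c' p = if c = c' then 1 else 0 := by
      have h1 : coordAlong F p (fun q ↦ coordFrame (F p) c (F q)) p = finBasis ℝ E' c :=
        congrArg Prod.snd (Trivialization.apply_mk_symm _ (mem_baseSet_trivializationAt' (F p)) _)
      rw [coeffAlong, h1, Basis.coord_apply, Basis.repr_self, Finsupp.single_apply]
    simp only [h, ite_smul, one_smul, zero_smul, smul_ite, smul_zero, Finset.sum_ite_eq,
      Finset.mem_univ, if_true]

end Curvature

/-! ### Algebra of curvature tensors -/

section Algebra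

variable {V : Type*} [NormedAddCommGroup V] [InnerProductSpace ℝ V]

/-- Cramer's rule: pairing a linear relation with u and v gives a 2 × 2 system whose determinant is
the Gram determinant. -/
theorem linearIndependent_pair_of_inner {u v : V}
    (h : inner ℝ u u * inner ℝ v v - inner ℝ u v ^ 2 ≠ 0) : LinearIndependent ℝ ![u, v] := by
  rw [LinearIndependent.pair_iff]
  intro s t hst
  have h1 := congrArg (fun w ↦ inner ℝ w u) hst
  have h2 := congrArg (fun w ↦ inner ℝ w v) hst
  simp only [inner_add_left, real_inner_smul_left, inner_zero_left, real_inner_comm u v] at h1 h2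
  constructor
  · refine (mul_eq_zero.1 ?_).resolve_right h
    linear_combination inner ℝ v v * h1 - inner ℝ u v * h2
  · refine (mul_eq_zero.1 ?_).resolve_right h
    linear_combination inner ℝ u u * h2 - inner ℝ u v * h1

/-- The symmetries of the curvature tensor of a Riemannian manifold. -/
structure IsCurvatureLike (R : V →ₗ[ℝ] V →ₗ[ℝ] V →ₗ[ℝ] V) : Prop where
  swap (u v w : V) : R u v w = -R v u w
  inner_self (u v w : V) : inner ℝ (R u v w) w = 0
  bianchi (u v w : V) : R u v w + R v w u + R w u v = 0

namespace IsCurvatureLike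

variable {R : V →ₗ[ℝ] V →ₗ[ℝ] V →ₗ[ℝ] V}

theorem inner_swap (h : IsCurvatureLike R) (u v w z : V) :
    inner ℝ (R u v w) z = -inner ℝ (R v u w) z := by
  rw [h.swap, inner_neg_left]

theorem inner_skew (h : IsCurvatureLike R) (u v w z : V) :
    inner ℝ (R u v w) z = -inner ℝ (R u v z) w := by
  have h1 := h.inner_self u v (w + z)
  rw [map_add, inner_add_left, inner_add_right, inner_add_right, h.inner_self, h.inner_self] at h1
  linarith

theorem inner_bianchi (h : IsCurvatureLike R) (u v w z : V) :
    inner ℝ (R u v w) z + inner ℝ (R v w u) z + inner ℝ (R w u v) z = 0 := by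
  rw [← inner_add_left, ← inner_add_left, h.bianchi, inner_zero_left]

/-- The octahedron argument: combine the four Bianchi identities on u, v, w, z with skew-symmetry in
each pair. -/
theorem inner_pair (h : IsCurvatureLike R) (u v w z : V) :
    inner ℝ (R u v w) z = inner ℝ (R w z u) v := by
  linarith [h.inner_bianchi u v w z, h.inner_bianchi v w z u, h.inner_bianchi w z u v,
    h.inner_bianchi z u v w, h.inner_skew u v w z, h.inner_skew v w u z, h.inner_skew w u v z,
    h.inner_skew v w z u, h.inner_skew w z v u, h.inner_skew z v w u, h.inner_skew w z u v,
    h.inner_skew z u w v, h.inner_skew u w z v, h.inner_skew z u v w, h.inner_skew u v z w,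
    h.inner_skew v z u w, h.inner_swap u v w z, h.inner_swap w u v z, h.inner_swap v z u w,
    h.inner_swap z v w u, h.inner_swap z u v w, h.inner_swap u w z v, h.inner_swap w u z v,
    h.inner_swap z v u w]

/-- Equality in Cauchy–Schwarz makes v a multiple of u when u ≠ 0, and R(u,u) = 0. This covers the
pairs that span no plane. -/
theorem inner_eq_zero (h : IsCurvatureLike R) {u v : V}
    (huv : inner ℝ u u * inner ℝ v v - inner ℝ u v ^ 2 = 0) : inner ℝ (R u v v) u = 0 := by
  by_cases hu : u = 0
  · simp [hu]
  have h0 : inner ℝ u u ≠ 0 := inner_self_ne_zero.2 hu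
  have hw : inner ℝ u u • v - inner ℝ u v • u = 0 := by
    rw [← inner_self_eq_zero (𝕜 := ℝ)]
    simp only [inner_sub_left, inner_sub_right, real_inner_smul_left, real_inner_smul_right,
      real_inner_comm u v]
    linear_combination inner ℝ u u * huv
  have h1 : inner ℝ (R u u v) u = 0 := by linarith [h.inner_swap u u v u]
  have h2 := congrArg (fun w ↦ inner ℝ (R u w v) u) (sub_eq_zero.1 hw)
  simp only [map_smul, LinearMap.smul_apply, real_inner_smul_left, h1, mul_zero] at h2
  exact (mul_eq_zero.1 h2).resolve_left h0

/-- A curvature tensor with constant sectional curvature is determined by it. -/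
theorem eq_of_sectional (h : IsCurvatureLike R) {c : ℝ}
    (hc : ∀ u v : V, inner ℝ (R u v v) u
      = c * (inner ℝ u u * inner ℝ v v - inner ℝ u v ^ 2)) (u v w : V) :
    R u v w = (c * inner ℝ v w) • u - (c * inner ℝ u w) • v := by
  -- Polarization in the second vector; `h2` then polarizes in the first.
  have h1 (u v w : V) : inner ℝ (R u v w) u
      = c * (inner ℝ u u * inner ℝ v w - inner ℝ u v * inner ℝ u w) := by
    have h2 := hc u (v + w)
    simp only [map_add, LinearMap.add_apply, inner_add_left, inner_add_right] at h2
    have h3 : inner ℝ (R u w v) u = inner ℝ (R u v w) u := by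
      rw [h.inner_pair u w v u, h.inner_swap, h.inner_skew, neg_neg]
    have h4 := real_inner_comm v w
    linear_combination h2 / 2 - hc u v / 2 - hc u w / 2 - h3 / 2 + c * inner ℝ u u * h4 / 2
  have h2 (u v w z : V) : inner ℝ (R u v w) z + inner ℝ (R u w v) z
      = c * (2 * inner ℝ u z * inner ℝ v w - inner ℝ u v * inner ℝ z w
        - inner ℝ z v * inner ℝ u w) := by
    have h3 := h1 (u + z) v w
    simp only [map_add, LinearMap.add_apply, inner_add_left, inner_add_right] at h3
    have h4 : inner ℝ (R z v w) u = inner ℝ (R u w v) z := by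
      rw [h.inner_pair z v w u, h.inner_swap, h.inner_skew, neg_neg]
    have h5 := real_inner_comm u z
    linear_combination h3 - h1 u v w - h1 z v w - h4 + c * inner ℝ v w * h5
  refine ext_inner_right ℝ fun z ↦ ?_
  rw [inner_sub_left, real_inner_smul_left, real_inner_smul_left]
  -- By Bianchi, R(u,w)v - R(v,w)u = R(u,v)w, so antisymmetrizing `h2` in u and v gives three times
  -- R(u,v)w.
  have h3 := h.inner_bianchi u v w z
  have h4 := h.inner_swap w u v z
  have h5 := h.inner_swap v u w z
  have k1 := h2 u v w z
  have k2 := h2 v u w z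
  rw [real_inner_comm v z] at k1
  rw [real_inner_comm u z, real_inner_comm u v] at k2
  linear_combination (k1 - k2 + h3 + h5 - h4) / 3

/-- A Kähler curvature tensor with constant holomorphic sectional curvature has constant
sectional curvature on totally real planes. -/
theorem totallyReal_sectional (h : IsCurvatureLike R) {J : V →L[ℝ] V} {μ : ℝ}
    (hJ2 : ∀ v, J (J v) = -v) (hJ : ∀ v w : V, inner ℝ (J v) (J w) = inner ℝ v w)
    (hRJ : ∀ u v w, R u v (J w) = J (R u v w))
    (hμ : ∀ u, inner ℝ (R u (J u) (J u)) u = μ * inner ℝ u u ^ 2)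
    {u v : V} (huv : inner ℝ u v = 0) (huJv : inner ℝ u (J v) = 0) :
    inner ℝ (R u v v) u = μ / 4 * (inner ℝ u u * inner ℝ v v) := by
  have inv2 (a b c d : V) : inner ℝ (R a b (J c)) (J d) = inner ℝ (R a b c) d := by rw [hRJ, hJ]
  have inv1 (a b c d : V) : inner ℝ (R (J a) (J b) c) d = inner ℝ (R a b c) d := by
    rw [h.inner_pair, inv2, ← h.inner_pair]
  -- Adding `hμ` for u + v and u - v removes the terms odd in v. The remaining mixed terms reduce,
  -- by J-invariance and Bianchi, to these two.
  have key (u v : V) (huv : inner ℝ u v = 0) :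
      inner ℝ (R u v v) u + 3 * inner ℝ (R u (J v) (J v)) u = μ * (inner ℝ u u * inner ℝ v v) := by
    have hvu : inner ℝ v u = 0 := by rw [real_inner_comm, huv]
    have h1 := hμ (u + v)
    have h2 := hμ (u - v)
    simp only [map_add, map_sub, LinearMap.add_apply, LinearMap.sub_apply, inner_add_left,
      inner_add_right, inner_sub_left, inner_sub_right, huv, hvu] at h1 h2
    have m1 (a b c d : V) : inner ℝ (R a (J b) c) d = inner ℝ (R b (J a) c) d := by
      rw [← inv1 a (J b), hJ2, map_neg, LinearMap.neg_apply, inner_neg_left, h.inner_swap, neg_neg]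
    have m2 (a b c d : V) : inner ℝ (R a b (J c)) d = inner ℝ (R a b (J d)) c := by
      rw [← inv2 a b (J c), hJ2, map_neg, inner_neg_left, h.inner_skew, neg_neg]
    have p : inner ℝ (R v (J v) (J u)) u = inner ℝ (R u (J u) (J v)) v := by
      rw [h.inner_pair, h.inner_swap, h.inner_skew, neg_neg]
    have b := h.inner_bianchi u (J u) (J v) v
    rw [inv1, h.inner_skew u v u v, h.inner_swap (J v) u, m2 u (J v) u v] at b
    linear_combination (h1 + h2) / 4 - hμ u / 2 - hμ v / 2 - p / 2 - b
      - m1 v u (J v) u / 2 - m1 v u (J u) v / 2 - m2 u (J v) u v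
  -- Replacing v by Jv exchanges the two terms. The two equations in two unknowns give 8⟨R(u,v)v,u⟩
  -- = 2μ|u|²|v|².
  have k1 := key u v huv
  have k2 := key u (J v) huJv
  simp only [hJ2, map_neg, LinearMap.neg_apply, neg_neg, hJ] at k2
  linarith

end IsCurvatureLike

end Algebra

/-! ### The curvature tensor of a Riemannian manifold -/

section CurvatureTensor

variable {E' : Type*} [NormedAddCommGroup E'] [NormedSpace ℝ E']
  {N : Type*} [TopologicalSpace N] [ChartedSpace E' N]
  {x : N} {X Y Z : Π x : N, TangentSpace 𝓘(ℝ, E') x}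

theorem differential_id (u : TangentSpace 𝓘(ℝ, E') x) :
    differential (ContMDiffMap.id : C^∞⟮𝓘(ℝ, E'), N; 𝓘(ℝ, E'), N⟯) x u = u :=
  congrArg (fun L : E' →L[ℝ] E' ↦ L u) (mfderiv_id (I := 𝓘(ℝ, E')) (x := x))

variable [FiniteDimensional ℝ E'] [IsManifold 𝓘(ℝ, E') ∞ N]
  [RiemannianBundle (fun x : N ↦ TangentSpace 𝓘(ℝ, E') x)]
  [IsContMDiffRiemannianBundle 𝓘(ℝ, E') ∞ E' (fun x : N ↦ TangentSpace 𝓘(ℝ, E') x)]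

theorem covDerivAlong_id (hZ : MDiffAt (T% Z) x) (u : TangentSpace 𝓘(ℝ, E') x) :
    covDerivAlong (ContMDiffMap.id : C^∞⟮𝓘(ℝ, E'), N; 𝓘(ℝ, E'), N⟯) Z x u = leviCivita Z x u :=
  (covDerivAlong_comp (F := ContMDiffMap.id) hZ u).trans
    (congrArg (leviCivita Z x) (differential_id u))

/-- The case of the identity map in `curvatureAlong_eq`. It shows that the curvature depends only on
the values of the fields at x. -/
theorem curvature_eq_curvatureTensor (hX : CMDiffAt ∞ (T% X) x) (hY : CMDiffAt ∞ (T% Y) x)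
    (hZ : CMDiffAt ∞ (T% Z) x) : curvature X Y Z x = curvatureTensor x (X x) (Y x) (Z x) := by
  have h := curvatureAlong_eq (F := (ContMDiffMap.id : C^∞⟮𝓘(ℝ, E'), N; 𝓘(ℝ, E'), N⟯)) (V := Z)
    hX hY hZ
  have h1 {W : Π x : N, TangentSpace 𝓘(ℝ, E') x} (hW : CMDiffAt ∞ (T% W) x)
      (u : TangentSpace 𝓘(ℝ, E') x) : covDerivAlong
      (ContMDiffMap.id : C^∞⟮𝓘(ℝ, E'), N; 𝓘(ℝ, E'), N⟯) (fun q ↦ covDerivAlong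
      (ContMDiffMap.id : C^∞⟮𝓘(ℝ, E'), N; 𝓘(ℝ, E'), N⟯) Z q (W q)) x u
      = leviCivita (fun q ↦ leviCivita Z q (W q)) x u := by
    rw [← covDerivAlong_id ((contMDiffAt_leviCivita hW hZ).mdifferentiableAt (by simp))]
    refine congrArg (fun L : TangentSpace 𝓘(ℝ, E') x →L[ℝ] TangentSpace 𝓘(ℝ, E') x ↦ L u)
      (covDerivAlong_congr ?_)
    filter_upwards [ContMDiffAt.eventually_mdifferentiableAt_section hZ] with q hq
    exact covDerivAlong_id hq _
  rw [differential_id, differential_id] at h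
  let sub (u v : TangentSpace 𝓘(ℝ, E') x) := u - v
  exact (congrArg₂ sub (congrArg₂ sub (h1 hY (X x)) (h1 hX (Y x)))
    (covDerivAlong_id (hZ.mdifferentiableAt (by simp)) _)).symm.trans h

/-- By tensoriality the identities may be checked on extensions: `inner_self` comes from metric
compatibility, `bianchi` from vanishing torsion and the Jacobi identity. -/
theorem isCurvatureLike_curvatureTensor (x : N) :
    IsCurvatureLike (V := TangentSpace 𝓘(ℝ, E') x) (curvatureTensor x) where
  swap u v w := by
    have h (v : TangentSpace 𝓘(ℝ, E') x) := contMDiffAt_extend (k := ∞) 𝓘(ℝ, E') E' v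
    have h1 := curvature_eq_curvatureTensor (h u) (h v) (h w)
    have h2 := curvature_eq_curvatureTensor (h v) (h u) (h w)
    simp only [extend_apply_self] at h1 h2
    rw [← h1, ← h2, curvature, curvature, mlieBracket_swap_apply, map_neg]
    abel
  inner_self u v w := by
    have h (v : TangentSpace 𝓘(ℝ, E') x) := contMDiffAt_extend (k := ∞) 𝓘(ℝ, E') E' v
    have hd (v : TangentSpace 𝓘(ℝ, E') x) := mdifferentiableAt_extend 𝓘(ℝ, E') E' v
    have h1 := curvature_eq_curvatureTensor (h u) (h v) (h w)
    simp only [extend_apply_self] at h1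
    -- Expand the commutator of derivatives of |w|²: products of first derivatives are symmetric in
    -- u, v and cancel, leaving 2⟨R(u,v)w,w⟩ = 0.
    have h2 := mvfderiv_mlieBracket (h u) (h v) (contMDiffAt_inner_bundle (h w) (h w))
    have h3 (v : TangentSpace 𝓘(ℝ, E') x) : ∀ᶠ q in 𝓝 x,
        d% (fun q ↦ inner ℝ (extend E' w q) (extend E' w q)) q (extend E' v q)
          = 2 * inner ℝ (leviCivita (extend E' w) q (extend E' v q)) (extend E' w q) := by
      filter_upwards [ContMDiffAt.eventually_mdifferentiableAt_section (h w),
        ContMDiffAt.eventually_mdifferentiableAt_section (h v)] with q hq hq'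
      rw [leviCivita_metric hq' hq hq, real_inner_comm]
      ring
    have h4 (v u : TangentSpace 𝓘(ℝ, E') x) :
        d% (fun q ↦ d% (fun q ↦ inner ℝ (extend E' w q) (extend E' w q)) q (extend E' v q)) x u
          = 2 * (inner ℝ (leviCivita (fun q ↦ leviCivita (extend E' w) q (extend E' v q)) x u) w
            + inner ℝ (leviCivita (extend E' w) x v) (leviCivita (extend E' w) x u)) := by
      have hL := (contMDiffAt_leviCivita (h v) (h w)).mdifferentiableAt (by simp)
      have h5 := leviCivita_metric (hd u) hL (hd w)
      simp only [extend_apply_self] at h5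
      rw [mvfderiv_congr (h3 v), mvfderiv_fun_mul mdifferentiableAt_const
        (mdifferentiableAt_inner hL (hd w)), ← h5]
      simp [mvfderiv_const]
    have h6 := leviCivita_metric (mdifferentiableAt_extend 𝓘(ℝ, E') E'
      (mlieBracket 𝓘(ℝ, E') (extend E' u) (extend E' v) x)) (hd w) (hd w)
    simp only [extend_apply_self] at h2 h6
    rw [h4, h4, h6] at h2
    rw [← h1, curvature, inner_sub_left, inner_sub_left]
    simp only [extend_apply_self]
    linarith [real_inner_comm (leviCivita (extend E' w) x u) (leviCivita (extend E' w) x v),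
      real_inner_comm w (leviCivita (extend E' w) x
        (mlieBracket 𝓘(ℝ, E') (extend E' u) (extend E' v) x))]
  bianchi u v w := by
    have h (v : TangentSpace 𝓘(ℝ, E') x) := contMDiffAt_extend (k := ∞) 𝓘(ℝ, E') E' v
    have hd (v : TangentSpace 𝓘(ℝ, E') x) := mdifferentiableAt_extend 𝓘(ℝ, E') E' v
    have hR (u v w : TangentSpace 𝓘(ℝ, E') x) : curvatureTensor x u v w
        = leviCivita (fun q ↦ leviCivita (extend E' w) q (extend E' v q)) x u
          - leviCivita (fun q ↦ leviCivita (extend E' w) q (extend E' u q)) x v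
          - leviCivita (extend E' w) x (mlieBracket 𝓘(ℝ, E') (extend E' u) (extend E' v) x) := by
      have h1 := curvature_eq_curvatureTensor (h u) (h v) (h w)
      simp only [extend_apply_self] at h1
      rw [← h1, curvature]
      simp only [extend_apply_self]
    -- Vanishing torsion, used twice: ∇_u(∇_v w - ∇_w v) - ∇_[v,w] u = ∇_u[v,w] - ∇_[v,w] u =
    -- [u,[v,w]].
    have hT (u v w : TangentSpace 𝓘(ℝ, E') x) :
        leviCivita (fun q ↦ leviCivita (extend E' w) q (extend E' v q)) x u
          - leviCivita (fun q ↦ leviCivita (extend E' v) q (extend E' w q)) x u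
          - leviCivita (extend E' u) x (mlieBracket 𝓘(ℝ, E') (extend E' v) (extend E' w) x)
        = mlieBracket 𝓘(ℝ, E') (extend E' u)
          (mlieBracket 𝓘(ℝ, E') (extend E' v) (extend E' w)) x := by
      have hvw := (contMDiffAt_mlieBracket (h v) (h w)).mdifferentiableAt (by simp)
      have hwv := (contMDiffAt_leviCivita (h w) (h v)).mdifferentiableAt (by simp)
      have h1 : leviCivita (fun q ↦ leviCivita (extend E' w) q (extend E' v q)) x
          = leviCivita (mlieBracket 𝓘(ℝ, E') (extend E' v) (extend E' w)
            + fun q ↦ leviCivita (extend E' v) q (extend E' w q)) x := by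
        refine leviCivita_congr ((contMDiffAt_leviCivita (h v) (h w)).mdifferentiableAt (by simp)) ?_
        filter_upwards [ContMDiffAt.eventually_mdifferentiableAt_section (h w),
          ContMDiffAt.eventually_mdifferentiableAt_section (h v)] with q hq hq'
        rw [Pi.add_apply, ← leviCivita_torsion hq' hq, sub_add_cancel]
      have h2 := leviCivita_torsion (hd u) hvw
      rw [extend_apply_self] at h2
      rw [h1, leviCivita_add hvw hwv, add_apply, add_sub_cancel_right, h2]
    have hjac : mlieBracket 𝓘(ℝ, E') (extend E' u)
          (mlieBracket 𝓘(ℝ, E') (extend E' v) (extend E' w)) x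
        + mlieBracket 𝓘(ℝ, E') (extend E' v)
          (mlieBracket 𝓘(ℝ, E') (extend E' w) (extend E' u)) x
        + mlieBracket 𝓘(ℝ, E') (extend E' w)
          (mlieBracket 𝓘(ℝ, E') (extend E' u) (extend E' v)) x = 0 := by
      have : IsManifold 𝓘(ℝ, E') (minSmoothness ℝ 3) N :=
        .of_le (n := ∞) (by simpa using ENat.LEInfty.out)
      have h2 (v : TangentSpace 𝓘(ℝ, E') x) : CMDiffAt (minSmoothness ℝ 2) (T% (extend E' v)) x :=
        (h v).of_le (by simpa using ENat.LEInfty.out)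
      have hwu := (contMDiffAt_mlieBracket (h w) (h u)).mdifferentiableAt (by simp)
      rw [leibniz_identity_mlieBracket_apply (h2 u) (h2 v) (h2 w),
        mlieBracket_swap (V := extend E' u) (W := extend E' w), ← neg_one_smul ℝ (mlieBracket _ _ _),
        mlieBracket_const_smul_right hwu, mlieBracket_swap_apply (W := extend E' w)]
      module
    rw [← hT, ← hT, ← hT] at hjac
    rw [hR, hR, hR, ← hjac]
    abel

/-- A Kähler structure commutes with the curvature tensor. -/
theorem IsKaehler.curvatureTensor_comm
    {J : Π x : N, TangentSpace 𝓘(ℝ, E') x →L[ℝ] TangentSpace 𝓘(ℝ, E') x} (hJ : IsKaehler J)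
    (u v w : TangentSpace 𝓘(ℝ, E') x) :
    curvatureTensor x u v (J x w) = J x (curvatureTensor x u v w) := by
  have h (v : TangentSpace 𝓘(ℝ, E') x) := contMDiffAt_extend (k := ∞) 𝓘(ℝ, E') E' v
  have h1 := curvature_eq_curvatureTensor (h u) (h v) (h w)
  have h2 := curvature_eq_curvatureTensor (h u) (h v) (contMDiffAt_kaehler hJ (h w))
  have h3 {q : N} {W : Π x : N, TangentSpace 𝓘(ℝ, E') x} (hW : MDiffAt (T% W) q)
      (v : TangentSpace 𝓘(ℝ, E') q) :
      leviCivita (fun y ↦ J y (W y)) q v = J q (leviCivita W q v) := by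
    have hJW : MDiffAt (T% (fun y ↦ J y (W y))) q :=
      MDiffAlongAt.kaehler (F := ContMDiffMap.id) hJ hW
    rw [← covDerivAlong_id hJW, ← covDerivAlong_id hW]
    exact covDerivAlong_kaehler (F := ContMDiffMap.id) hJ hW v
  have h4 (u v : TangentSpace 𝓘(ℝ, E') x) :
      leviCivita (fun q ↦ leviCivita (fun y ↦ J y (extend E' w y)) q (extend E' v q)) x u
        = J x (leviCivita (fun q ↦ leviCivita (extend E' w) q (extend E' v q)) x u) := by
    have hL := contMDiffAt_leviCivita (h v) (h w)
    rw [← h3 (hL.mdifferentiableAt (by simp))]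
    refine congrArg (fun L : TangentSpace 𝓘(ℝ, E') x →L[ℝ] TangentSpace 𝓘(ℝ, E') x ↦ L u)
      (leviCivita_congr ((contMDiffAt_leviCivita (h v)
        (contMDiffAt_kaehler hJ (h w))).mdifferentiableAt (by simp)) ?_)
    filter_upwards [ContMDiffAt.eventually_mdifferentiableAt_section (h w)] with q hq
    exact h3 hq _
  simp only [extend_apply_self] at h1 h2
  rw [← h1, ← h2, curvature, curvature, h4, h4,
    h3 (mdifferentiableAt_extend 𝓘(ℝ, E') E' w), map_sub, map_sub]

theorem HasConstantCurvature.curvatureTensor_eq {c : ℝ} (hc : HasConstantCurvature E' N c)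
    (u v w : TangentSpace 𝓘(ℝ, E') x) :
    curvatureTensor x u v w = (c * inner ℝ v w) • u - (c * inner ℝ u w) • v := by
  have hR := isCurvatureLike_curvatureTensor (E' := E') x
  refine hR.eq_of_sectional (V := TangentSpace 𝓘(ℝ, E') x) (fun u v ↦ ?_) u v w
  -- The hypothesis concerns independent pairs only; on a dependent pair both sides vanish.
  by_cases hd : inner ℝ u u * inner ℝ v v - inner ℝ u v ^ 2 = 0
  · rw [hd, mul_zero]
    exact hR.inner_eq_zero hd
  · have h (v : TangentSpace 𝓘(ℝ, E') x) := contMDiffAt_extend (k := ∞) 𝓘(ℝ, E') E' v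
    have h1 := hc x (extend E' u) (extend E' v) (h u) (h v)
      (by simpa using linearIndependent_pair_of_inner hd)
    rw [sectionalCurvature, curvature_eq_curvatureTensor (h u) (h v) (h v)] at h1
    simp only [extend_apply_self] at h1
    rw [← h1, div_mul_cancel₀ _ hd]

/-- Since Ju ⟂ u and |Ju| = |u|, the denominator of the sectional curvature is |u|⁴. -/
theorem IsComplexSpaceForm.inner_curvatureTensor
    {J : Π x : N, TangentSpace 𝓘(ℝ, E') x →L[ℝ] TangentSpace 𝓘(ℝ, E') x} {μ : ℝ}
    (hN : IsComplexSpaceForm J μ) (u : TangentSpace 𝓘(ℝ, E') x) :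
    inner ℝ (curvatureTensor x u (J x u) (J x u)) u = μ * inner ℝ u u ^ 2 := by
  by_cases hu : u = 0
  · simp [hu]
  have h := contMDiffAt_extend (k := ∞) 𝓘(ℝ, E') E' u
  have hJ := contMDiffAt_kaehler hN.isKaehler h
  have h1 := hN.holomorphic_curvature x (extend E' u) h (by simpa using hu)
  rw [sectionalCurvature, curvature_eq_curvatureTensor h hJ hJ] at h1
  simp only [extend_apply_self, hN.isKaehler.isometry] at h1
  have h2 : inner ℝ u (J x u) = 0 := by
    have h3 := hN.isKaehler.isometry x u (J x u)
    rw [hN.isKaehler.sq, inner_neg_right, real_inner_comm] at h3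
    linarith
  have h4 : inner ℝ u u ≠ 0 := inner_self_ne_zero.2 hu
  rw [h2, div_eq_iff (by simpa using hu)] at h1
  rw [h1]
  ring

end CurvatureTensor

/-! ### The second fundamental form -/

section SecondFundamentalForm

variable {E : Type*} [NormedAddCommGroup E] [NormedSpace ℝ E] [FiniteDimensional ℝ E]
  {M : Type*} [TopologicalSpace M] [ChartedSpace E M] [IsManifold 𝓘(ℝ, E) ∞ M]
  [RiemannianBundle (fun x : M ↦ TangentSpace 𝓘(ℝ, E) x)]
  [IsContMDiffRiemannianBundle 𝓘(ℝ, E) ∞ E (fun x : M ↦ TangentSpace 𝓘(ℝ, E) x)]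
  {E' : Type*} [NormedAddCommGroup E'] [NormedSpace ℝ E'] [FiniteDimensional ℝ E']
  {N : Type*} [TopologicalSpace N] [ChartedSpace E' N] [IsManifold 𝓘(ℝ, E') ∞ N]
  [RiemannianBundle (fun x : N ↦ TangentSpace 𝓘(ℝ, E') x)]
  [IsContMDiffRiemannianBundle 𝓘(ℝ, E') ∞ E' (fun x : N ↦ TangentSpace 𝓘(ℝ, E') x)]
  {F : C^∞⟮𝓘(ℝ, E), M; 𝓘(ℝ, E'), N⟯} {p : M} {X Y Z W : Π q : M, TangentSpace 𝓘(ℝ, E) q}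

/-- Both connections produce the same derivative term (Xf) dF(Y), which cancels in the difference.
-/
theorem tensorialAt_secondFundamentalForm (F : C^∞⟮𝓘(ℝ, E), M; 𝓘(ℝ, E'), N⟯) (p : M)
    (X : Π q : M, TangentSpace 𝓘(ℝ, E) q) :
    TensorialAt 𝓘(ℝ, E) E (fun Y ↦ secondFundamentalForm F X Y p) p where
  smul {f Y} hf hY := by
    simp only [secondFundamentalForm, Pi.smul_apply', map_smul]
    rw [covDerivAlong_smul hf (MDiffAlongAt.differential hY), leviCivita_smul hf hY]
    simp only [add_apply, smul_apply, ContinuousLinearMap.smulRight_apply, map_add, map_smul]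
    module
  add {Y Z} hY hZ := by
    simp only [secondFundamentalForm, Pi.add_apply, map_add]
    rw [covDerivAlong_add (MDiffAlongAt.differential hY) (MDiffAlongAt.differential hZ),
      leviCivita_add hY hZ, add_apply, add_apply, map_add]
    abel

/-- The second fundamental form as a bilinear map on the tangent space at `p`. -/
def sffTensor (F : C^∞⟮𝓘(ℝ, E), M; 𝓘(ℝ, E'), N⟯) (p : M) : TangentSpace 𝓘(ℝ, E) p →ₗ[ℝ]
    TangentSpace 𝓘(ℝ, E) p →ₗ[ℝ] TangentSpace 𝓘(ℝ, E') (F p) :=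
  LinearMap.mk₂ ℝ (fun u v ↦ covDerivAlong F (fun q ↦ differential F q (extend E v q)) p u
      - differential F p (leviCivita (extend E v) p u))
    (fun u u' v ↦ by simp only [map_add]; abel)
    (fun a u v ↦ by simp only [map_smul, smul_sub])
    (fun u v v' ↦ by
      have h := tensorialAt_secondFundamentalForm F p (fun q ↦ extend E u q)
      have hv (v : TangentSpace 𝓘(ℝ, E) p) := mdifferentiableAt_extend 𝓘(ℝ, E) E v
      have h1 := h.pointwise (hv (v + v')) (mdifferentiableAt_add_section (hv v) (hv v'))
        (by simp)
      rw [h.add (hv v) (hv v')] at h1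
      simpa only [secondFundamentalForm, extend_apply_self] using h1)
    (fun a u v ↦ by
      have h := tensorialAt_secondFundamentalForm F p (fun q ↦ extend E u q)
      have hv (v : TangentSpace 𝓘(ℝ, E) p) := mdifferentiableAt_extend 𝓘(ℝ, E) E v
      have ha : MDiffAt (fun _ : M ↦ a) p := mdifferentiableAt_const
      have h1 := h.pointwise (hv (a • v)) (ha.smul_section (hv v)) (by simp)
      rw [h.smul ha (hv v)] at h1
      simpa only [secondFundamentalForm, extend_apply_self] using h1)

theorem secondFundamentalForm_eq (hY : MDiffAt (T% Y) p) :
    secondFundamentalForm F X Y p = sffTensor F p (X p) (Y p) :=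
  (tensorialAt_secondFundamentalForm F p X).pointwise hY
    (mdifferentiableAt_extend 𝓘(ℝ, E) E (Y p)) (by simp)

/-- The Gauss formula. -/
theorem covDerivAlong_differential (hY : MDiffAt (T% Y) p) (u : TangentSpace 𝓘(ℝ, E) p) :
    covDerivAlong F (fun q ↦ differential F q (Y q)) p u
      = differential F p (leviCivita Y p u) + sffTensor F p u (Y p) := by
  have h := secondFundamentalForm_eq (F := F) (X := extend E u) hY
  rw [secondFundamentalForm, extend_apply_self] at h
  rw [← h, add_sub_cancel]

/-- Both connections are torsion free, so the antisymmetric part of σ is dF[u,v] - dF[u,v]. -/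
theorem sffTensor_comm (u v : TangentSpace 𝓘(ℝ, E) p) : sffTensor F p u v = sffTensor F p v u := by
  have hd (v : TangentSpace 𝓘(ℝ, E) p) := mdifferentiableAt_extend 𝓘(ℝ, E) E v
  have h1 := covDerivAlong_torsion (F := F) (contMDiffAt_extend (k := ∞) 𝓘(ℝ, E) E u)
    (contMDiffAt_extend (k := ∞) 𝓘(ℝ, E) E v)
  rw [covDerivAlong_differential (hd v), covDerivAlong_differential (hd u),
    ← leviCivita_torsion (hd u) (hd v), map_sub] at h1
  simp only [extend_apply_self] at h1
  rw [← sub_eq_zero] at h1 ⊢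
  rw [← h1]
  abel

/-- Both connections are metric, so ⟨σ(u,v), dF w⟩ is skew in v, w; it is symmetric in u, v, and
such a trilinear form is zero. -/
theorem inner_sffTensor (hF : IsIsometricImmersion F) (u v w : TangentSpace 𝓘(ℝ, E) p) :
    inner ℝ (sffTensor F p u v) (differential F p w) = 0 := by
  have hd (v : TangentSpace 𝓘(ℝ, E) p) := mdifferentiableAt_extend 𝓘(ℝ, E) E v
  have h (u v w : TangentSpace 𝓘(ℝ, E) p) : inner ℝ (sffTensor F p u v) (differential F p w)
      = -inner ℝ (sffTensor F p u w) (differential F p v) := by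
    have h1 := mvfderiv_inner_along (MDiffAlongAt.differential (F := F) (hd v))
      (MDiffAlongAt.differential (F := F) (hd w)) u
    have h2 := leviCivita_metric (hd u) (hd v) (hd w)
    simp only [hF _ _ _] at h1
    simp only [extend_apply_self] at h2
    rw [h2, covDerivAlong_differential (hd v), covDerivAlong_differential (hd w), inner_add_left,
      inner_add_right] at h1
    simp only [extend_apply_self, hF _ _ _] at h1
    linarith [real_inner_comm (sffTensor F p u w) (differential F p v)]
  have h1 := h u v w
  rw [sffTensor_comm u w, h w u v, sffTensor_comm w v, h v w u, sffTensor_comm v u] at h1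
  linarith

end SecondFundamentalForm

/-! ### The normal bundle -/

section Normal

variable {E : Type*} [NormedAddCommGroup E] [NormedSpace ℝ E]
  {M : Type*} [TopologicalSpace M] [ChartedSpace E M]
  {E' : Type*} [NormedAddCommGroup E'] [NormedSpace ℝ E']
  {N : Type*} [TopologicalSpace N] [ChartedSpace E' N]
  [RiemannianBundle (fun x : N ↦ TangentSpace 𝓘(ℝ, E') x)]
  {J : Π x : N, TangentSpace 𝓘(ℝ, E') x →L[ℝ] TangentSpace 𝓘(ℝ, E') x}
  {F : C^∞⟮𝓘(ℝ, E), M; 𝓘(ℝ, E'), N⟯} {p : M} {X Y : Π q : M, TangentSpace 𝓘(ℝ, E) q}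

theorem IsTotallyReal.inner_eq_zero (hreal : IsTotallyReal J F) (u v : TangentSpace 𝓘(ℝ, E) p) :
    inner ℝ (differential F p u) (J (F p) (differential F p v)) = 0 :=
  hreal p v _ (LinearMap.mem_range_self _ u)

variable [FiniteDimensional ℝ E']

theorem normalPart_differential (u : TangentSpace 𝓘(ℝ, E) p) :
    normalPart F p (differential F p u) = 0 :=
  (Submodule.starProjection_apply_eq_zero_iff _).2
    (Submodule.le_orthogonal_orthogonal _ (LinearMap.mem_range_self _ u))

theorem exists_of_normalPart_eq_zero {v : TangentSpace 𝓘(ℝ, E') (F p)}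
    (h : normalPart F p v = 0) : ∃ u, v = differential F p u := by
  have h1 := (Submodule.starProjection_apply_eq_zero_iff _).1 h
  rw [normalSpace, Submodule.orthogonal_orthogonal] at h1
  obtain ⟨u, hu⟩ := h1
  exact ⟨u, hu.symm⟩

theorem normalPart_of_mem {v : TangentSpace 𝓘(ℝ, E') (F p)} (h : v ∈ normalSpace F p) :
    normalPart F p v = v :=
  Submodule.starProjection_eq_self_iff.2 h

theorem normalPart_mem (v : TangentSpace 𝓘(ℝ, E') (F p)) : normalPart F p v ∈ normalSpace F p :=
  Submodule.starProjection_apply_mem _ _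

theorem normalPart_add (v w : TangentSpace 𝓘(ℝ, E') (F p)) :
    normalPart F p (v + w) = normalPart F p v + normalPart F p w :=
  map_add _ _ _

variable [IsManifold 𝓘(ℝ, E') ∞ N]
  [IsContMDiffRiemannianBundle 𝓘(ℝ, E') ∞ E' (fun x : N ↦ TangentSpace 𝓘(ℝ, E') x)]

theorem normalConn_congr {ξ η : Π q : M, TangentSpace 𝓘(ℝ, E') (F q)}
    (h : ∀ᶠ q in 𝓝 p, ξ q = η q) (u : TangentSpace 𝓘(ℝ, E) p) :
    normalConn F ξ p u = normalConn F η p u := by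
  rw [normalConn, normalConn, covDerivAlong_congr h]

theorem normalCurvature_congr {ξ η : Π q : M, TangentSpace 𝓘(ℝ, E') (F q)}
    (h : ∀ᶠ q in 𝓝 p, ξ q = η q) : normalCurvature F X Y ξ p = normalCurvature F X Y η p := by
  have h1 (Z : Π q : M, TangentSpace 𝓘(ℝ, E) q) :
      ∀ᶠ q in 𝓝 p, normalConn F ξ q (Z q) = normalConn F η q (Z q) :=
    h.eventually_nhds.mono fun q hq ↦ normalConn_congr hq _
  rw [normalCurvature, normalCurvature, normalConn_congr (h1 Y), normalConn_congr (h1 X),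
    normalConn_congr h]

end Normal

/-! ### Totally real submanifolds with parallel `f`-structure -/

section ParallelF

variable {E : Type*} [NormedAddCommGroup E] [NormedSpace ℝ E] [FiniteDimensional ℝ E]
  {M : Type*} [TopologicalSpace M] [ChartedSpace E M] [IsManifold 𝓘(ℝ, E) ∞ M]
  [RiemannianBundle (fun x : M ↦ TangentSpace 𝓘(ℝ, E) x)]
  [IsContMDiffRiemannianBundle 𝓘(ℝ, E) ∞ E (fun x : M ↦ TangentSpace 𝓘(ℝ, E) x)]
  {E' : Type*} [NormedAddCommGroup E'] [NormedSpace ℝ E'] [FiniteDimensional ℝ E']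
  {N : Type*} [TopologicalSpace N] [ChartedSpace E' N] [IsManifold 𝓘(ℝ, E') ∞ N]
  [RiemannianBundle (fun x : N ↦ TangentSpace 𝓘(ℝ, E') x)]
  [IsContMDiffRiemannianBundle 𝓘(ℝ, E') ∞ E' (fun x : N ↦ TangentSpace 𝓘(ℝ, E') x)]
  {J : Π x : N, TangentSpace 𝓘(ℝ, E') x →L[ℝ] TangentSpace 𝓘(ℝ, E') x}
  {F : C^∞⟮𝓘(ℝ, E), M; 𝓘(ℝ, E'), N⟯} {p : M} {X Y Z W : Π q : M, TangentSpace 𝓘(ℝ, E) q}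

theorem IsKaehler.inner_skew (hJ : IsKaehler J) {x : N} (v w : TangentSpace 𝓘(ℝ, E') x) :
    inner ℝ (J x v) w = -inner ℝ v (J x w) := by
  rw [← hJ.isometry x v (J x w), hJ.sq, inner_neg_right, neg_neg]

theorem covDerivAlong_kaehler_differential (hJ : IsKaehler J) (hY : MDiffAt (T% Y) p)
    (u : TangentSpace 𝓘(ℝ, E) p) :
    covDerivAlong F (fun q ↦ J (F q) (differential F q (Y q))) p u
      = J (F p) (differential F p (leviCivita Y p u)) + J (F p) (sffTensor F p u (Y p)) := by
  rw [covDerivAlong_kaehler hJ (MDiffAlongAt.differential hY), covDerivAlong_differential hY,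
    map_add]

/-- The second fundamental form takes values in `J T_p M`. -/
theorem exists_sffTensor_eq (hJ : IsKaehler J) (hF : IsIsometricImmersion F)
    (hreal : IsTotallyReal J F) (hf : HasParallelNormalF J F) (u v : TangentSpace 𝓘(ℝ, E) p) :
    ∃ a, sffTensor F p u v = J (F p) (differential F p a) := by
  have hv := contMDiffAt_extend (k := ∞) 𝓘(ℝ, E) E v
  -- Parallelity is tested on the normal field JY, where f(JY) = 0 identically.
  have h1 := hf p u (fun q ↦ J (F q) (differential F q (extend E v q))) (fun q ↦ hreal q _)
    ((SmoothAlongAt.differential hv).kaehler hJ)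
  have h2 (q : M) (u : TangentSpace 𝓘(ℝ, E) q) :
      normalF J F q (J (F q) (differential F q u)) = 0 := by
    rw [normalF, hJ.sq, ← map_neg, normalPart_differential]
  simp only [h2] at h1
  rw [normalConn, covDerivAlong_zero, normalConn,
    covDerivAlong_kaehler_differential hJ (hv.mdifferentiableAt (by simp)), normalPart_add,
    normalPart_of_mem (hreal p _), normalF, map_add, normalPart_add, hJ.sq, ← map_neg,
    normalPart_differential, zero_add, extend_apply_self] at h1
  have h0 : normalPart F p 0 = 0 := map_zero _
  rw [h0] at h1
  set s := sffTensor F p u v with hs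
  -- Here J((Js)^⊥) = dF b and the tangential part of Js is dF a; applying J gives s = -J(dF a) - dF
  -- b. Both s and J(dF a) are normal, so dF b = 0.
  obtain ⟨b, hb⟩ := exists_of_normalPart_eq_zero h1.symm
  obtain ⟨a, ha⟩ := exists_of_normalPart_eq_zero (v := J (F p) s - normalPart F p (J (F p) s)) (by
    have h3 : normalPart F p (J (F p) s - normalPart F p (J (F p) s))
        = normalPart F p (J (F p) s) - normalPart F p (normalPart F p (J (F p) s)) := map_sub _ _ _
    rw [h3, normalPart_of_mem (normalPart_mem _), sub_self])
  have h4 : s = -J (F p) (differential F p a) - differential F p b := by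
    rw [← ha, ← hb, map_sub, hJ.sq]
    abel
  have h5 : inner ℝ (differential F p b) (differential F p b) = 0 := by
    have h6 := inner_sffTensor hF u v b
    rw [← hs, h4, inner_sub_left, inner_neg_left, real_inner_comm, hreal.inner_eq_zero] at h6
    linarith
  refine ⟨-a, ?_⟩
  rw [h4, inner_self_eq_zero.1 h5, sub_zero, map_neg, map_neg]

/-- Differentiate ⟨dF v, J dF w⟩ = 0 and use that J is skew. With `sffTensor_comm` this makes the
cubic form totally symmetric. -/
theorem inner_sffTensor_swap (hJ : IsKaehler J) (hreal : IsTotallyReal J F)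
    (u v w : TangentSpace 𝓘(ℝ, E) p) :
    inner ℝ (sffTensor F p u v) (J (F p) (differential F p w))
      = inner ℝ (sffTensor F p u w) (J (F p) (differential F p v)) := by
  have hd (v : TangentSpace 𝓘(ℝ, E) p) := mdifferentiableAt_extend 𝓘(ℝ, E) E v
  have h1 := mvfderiv_inner_along (MDiffAlongAt.differential (F := F) (hd v))
    ((MDiffAlongAt.differential (F := F) (hd w)).kaehler hJ) u
  simp only [hreal.inner_eq_zero] at h1
  rw [mvfderiv_const, covDerivAlong_differential (hd v),
    covDerivAlong_kaehler_differential hJ (hd w), inner_add_left, inner_add_right] at h1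
  simp only [extend_apply_self, hreal.inner_eq_zero, zero_add] at h1
  have h2 := hJ.inner_skew (differential F p v) (sffTensor F p u w)
  have h3 := real_inner_comm (sffTensor F p u w) (J (F p) (differential F p v))
  have h4 : (0 : TangentSpace 𝓘(ℝ, E) p →L[ℝ] ℝ) u = 0 := rfl
  linarith

/-- The cubic form `⟨σ(u, v), J w⟩`. -/
def cubicForm (J : Π x : N, TangentSpace 𝓘(ℝ, E') x →L[ℝ] TangentSpace 𝓘(ℝ, E') x)
    (F : C^∞⟮𝓘(ℝ, E), M; 𝓘(ℝ, E'), N⟯) (p : M) : TangentSpace 𝓘(ℝ, E) p →ₗ[ℝ]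
    TangentSpace 𝓘(ℝ, E) p →ₗ[ℝ] TangentSpace 𝓘(ℝ, E) p →ₗ[ℝ] ℝ :=
  (sffTensor F p).compr₂ ((innerₗ (TangentSpace 𝓘(ℝ, E') (F p))).compl₂
    ((J (F p)).toLinearMap ∘ₗ (differential F p).toLinearMap))

theorem cubicForm_apply (u v w : TangentSpace 𝓘(ℝ, E) p) :
    cubicForm J F p u v w = inner ℝ (sffTensor F p u v) (J (F p) (differential F p w)) :=
  rfl

/-- As σ lies in J(TM), the term Jσ(u,W) is tangent and its normal part vanishes. So J ∘ dF carries
∇ to D, and hence R to R^⊥. -/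
theorem normalConn_kaehler_differential (hJ : IsKaehler J) (hF : IsIsometricImmersion F)
    (hreal : IsTotallyReal J F) (hf : HasParallelNormalF J F) (hW : MDiffAt (T% W) p)
    (u : TangentSpace 𝓘(ℝ, E) p) :
    normalConn F (fun q ↦ J (F q) (differential F q (W q))) p u
      = J (F p) (differential F p (leviCivita W p u)) := by
  obtain ⟨a, ha⟩ := exists_sffTensor_eq hJ hF hreal hf u (W p)
  rw [normalConn, covDerivAlong_kaehler_differential hJ hW, ha, hJ.sq, ← map_neg, normalPart_add,
    normalPart_differential, normalPart_of_mem (hreal p _), add_zero]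

theorem normalCurvature_kaehler_differential (hJ : IsKaehler J) (hF : IsIsometricImmersion F)
    (hreal : IsTotallyReal J F) (hf : HasParallelNormalF J F) (hX : CMDiffAt ∞ (T% X) p)
    (hY : CMDiffAt ∞ (T% Y) p) (hW : CMDiffAt ∞ (T% W) p) :
    normalCurvature F X Y (fun q ↦ J (F q) (differential F q (W q))) p
      = J (F p) (differential F p (curvature X Y W p)) := by
  have h1 {Z : Π q : M, TangentSpace 𝓘(ℝ, E) q} (hZ : CMDiffAt ∞ (T% Z) p)
      (u : TangentSpace 𝓘(ℝ, E) p) :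
      normalConn F (fun q ↦ normalConn F (fun q ↦ J (F q) (differential F q (W q))) q (Z q)) p u
        = J (F p) (differential F p (leviCivita (fun q ↦ leviCivita W q (Z q)) p u)) := by
    rw [← normalConn_kaehler_differential hJ hF hreal hf
      ((contMDiffAt_leviCivita hZ hW).mdifferentiableAt (by simp))]
    refine normalConn_congr ?_ u
    filter_upwards [ContMDiffAt.eventually_mdifferentiableAt_section hW] with q hq
    exact normalConn_kaehler_differential hJ hF hreal hf hq _
  rw [normalCurvature, h1 hY, h1 hX, normalConn_kaehler_differential hJ hF hreal hf
    (hW.mdifferentiableAt (by simp)), curvature, map_sub, map_sub, map_sub, map_sub]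

theorem smoothAlongAt_secondFundamentalForm (hX : CMDiffAt ∞ (T% X) p)
    (hY : CMDiffAt ∞ (T% Y) p) : SmoothAlongAt F (secondFundamentalForm F X Y) p :=
  ((SmoothAlongAt.differential hY).covDerivAlong hX).sub
    (SmoothAlongAt.differential (contMDiffAt_leviCivita hX hY))

theorem contMDiffAt_curvature (hX : CMDiffAt ∞ (T% X) p) (hY : CMDiffAt ∞ (T% Y) p)
    (hZ : CMDiffAt ∞ (T% Z) p) : CMDiffAt ∞ (T% (curvature X Y Z)) p :=
  ((contMDiffAt_leviCivita hX (contMDiffAt_leviCivita hY hZ)).sub_section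
    (contMDiffAt_leviCivita hY (contMDiffAt_leviCivita hX hZ))).sub_section
    (contMDiffAt_leviCivita (contMDiffAt_mlieBracket hX hY) hZ)

/-- For a semiparallel submanifold, the curvature tensor annihilates the cubic form. -/
theorem cubicForm_curvatureTensor (hJ : IsKaehler J) (hF : IsIsometricImmersion F)
    (hreal : IsTotallyReal J F) (hf : HasParallelNormalF J F) (hsemi : IsSemiparallel F)
    (x y z u t : TangentSpace 𝓘(ℝ, E) p) :
    cubicForm J F p (curvatureTensor p x y z) u t + cubicForm J F p z (curvatureTensor p x y u) t
      + cubicForm J F p z u (curvatureTensor p x y t) = 0 := by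
  have h (v : TangentSpace 𝓘(ℝ, E) p) := contMDiffAt_extend (k := ∞) 𝓘(ℝ, E) E v
  have hd (v : TangentSpace 𝓘(ℝ, E) p) := mdifferentiableAt_extend 𝓘(ℝ, E) E v
  choose W hW using fun q ↦ exists_sffTensor_eq hJ hF hreal hf (extend E z q) (extend E u q)
  have hWσ : ∀ᶠ q in 𝓝 p, secondFundamentalForm F (extend E z) (extend E u) q
      = J (F q) (differential F q (W q)) := by
    filter_upwards [ContMDiffAt.eventually_mdifferentiableAt_section (h u)] with q hq
    rw [secondFundamentalForm_eq hq, hW]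
  -- The choice of W carries no regularity, but ⟨W,T⟩ = ⟨σ(z,u), J dF T⟩ is smooth for every smooth
  -- T.
  have hWs : CMDiffAt ∞ (T% W) p := by
    refine contMDiffAt_of_inner fun T hT ↦ ?_
    refine ((smoothAlongAt_secondFundamentalForm (h z) (h u)).inner
      ((SmoothAlongAt.differential (F := F) hT).kaehler hJ)).congr_of_eventuallyEq ?_
    filter_upwards [hWσ] with q hq
    rw [hq, hJ.isometry, hF]
  have hWt (t : TangentSpace 𝓘(ℝ, E) p) : cubicForm J F p z u t = inner ℝ (W p) t := by
    have h1 := hW p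
    simp only [extend_apply_self] at h1
    rw [cubicForm_apply, h1, hJ.isometry, hF]
  have h1 := hsemi p (extend E x) (extend E y) (extend E z) (extend E u) (h x) (h y) (h z) (h u)
  rw [normalCurvature_congr hWσ,
    normalCurvature_kaehler_differential hJ hF hreal hf (h x) (h y) hWs,
    secondFundamentalForm_eq (hd u), secondFundamentalForm_eq
      ((contMDiffAt_curvature (h x) (h y) (h u)).mdifferentiableAt (by simp)),
    curvature_eq_curvatureTensor (h x) (h y) hWs, curvature_eq_curvatureTensor (h x) (h y) (h z),
    curvature_eq_curvatureTensor (h x) (h y) (h u)] at h1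
  simp only [extend_apply_self] at h1
  have h2 := congrArg (fun s ↦ inner ℝ s (J (F p) (differential F p t))) h1
  simp only [inner_sub_left, hJ.isometry, hF _ _ _, inner_zero_left] at h2
  -- Skewness of R(x,y) moves it from W to t, which turns the R^⊥ term into the third slot of the
  -- cubic form.
  have h3 := (isCurvatureLike_curvatureTensor p).inner_skew
    (V := TangentSpace 𝓘(ℝ, E) p) x y (W p) t
  rw [hWt, cubicForm_apply, cubicForm_apply]
  linarith [real_inner_comm (W p) (curvatureTensor p x y t)]

end ParallelF

/-! ### Rotation-invariant symmetric cubic forms. -/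

section CubicForms

variable {V : Type*} [NormedAddCommGroup V] [InnerProductSpace ℝ V]

theorem exists_ne_zero_inner_eq_zero (hV : 1 < finrank ℝ V) (x : V) :
    ∃ y : V, y ≠ 0 ∧ inner ℝ x y = 0 := by
  have : FiniteDimensional ℝ V := .of_finrank_pos (by lia)
  have h1 := Submodule.finrank_add_finrank_orthogonal (ℝ ∙ x)
  have h2 := finrank_span_le_card (R := ℝ) ({x} : Set V)
  rw [Set.toFinset_singleton, Finset.card_singleton] at h2
  have h3 : (ℝ ∙ x)ᗮ ≠ ⊥ := by
    intro h
    rw [h, finrank_bot] at h1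
    lia
  obtain ⟨y, hy, hy0⟩ := Submodule.exists_mem_ne_zero_of_ne_bot h3
  exact ⟨y, hy0, Submodule.mem_orthogonal_singleton_iff_inner_right.1 hy⟩

/-- A cubic form that is invariant under rotations vanishes. -/
theorem cubic_eq_zero (hV : 1 < finrank ℝ V) {C : V →ₗ[ℝ] V →ₗ[ℝ] V →ₗ[ℝ] ℝ}
    (h1 : ∀ u v w, C u v w = C v u w) (h2 : ∀ u v w, C u v w = C u w v)
    (h : ∀ x y z u t, C (inner ℝ y z • x - inner ℝ x z • y) u t
      + C z (inner ℝ y u • x - inner ℝ x u • y) t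
      + C z u (inner ℝ y t • x - inner ℝ x t • y) = 0) (u v w : V) : C u v w = 0 := by
  -- For x ⟂ y the rotation generator sends x to -|x|²y and y to |y|²x. On (x,x,x) invariance reads
  -- -3|x|²C(x,x,y) = 0.
  have h3 {x y : V} (hy : y ≠ 0) (hxy : inner ℝ x y = 0) : C x x y = 0 := by
    by_cases hx : x = 0
    · simp [hx]
    have h4 := h x y x x x
    simp only [real_inner_comm x y, hxy, zero_smul, zero_sub, map_neg, map_smul,
      LinearMap.neg_apply, LinearMap.smul_apply, smul_eq_mul] at h4
    rw [h1 y, ← h2 x x y] at h4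
    refine (mul_eq_zero.1 (?_ : inner ℝ x x * C x x y = 0)).resolve_left (inner_self_ne_zero.2 hx)
    linarith
  have h4 (x : V) : C x x x = 0 := by
    obtain ⟨y, hy, hxy⟩ := exists_ne_zero_inner_eq_zero hV x
    by_cases hx : x = 0
    · simp [hx]
    -- On (x,x,y) invariance reads |y|²C(x,x,x) = 2|x|²C(x,y,y), and the right side is zero by `h3`.
    have h5 := h x y x x y
    simp only [real_inner_comm x y, hxy, zero_smul, zero_sub, sub_zero, map_neg, map_smul,
      LinearMap.neg_apply, LinearMap.smul_apply, smul_eq_mul] at h5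
    have h6 : C y y x = 0 := h3 hx (by rw [real_inner_comm, hxy])
    rw [h1 x y y, h2 y x y, h6] at h5
    refine (mul_eq_zero.1 (?_ : inner ℝ y y * C x x x = 0)).resolve_left (inner_self_ne_zero.2 hy)
    linarith
  -- Polarization: a symmetric trilinear form is determined by its values on the diagonal.
  have e1 := h4 (u + v + w)
  have e2 := h4 (u + v)
  have e3 := h4 (u + w)
  have e4 := h4 (v + w)
  simp only [map_add, LinearMap.add_apply] at e1 e2 e3 e4
  linarith [h4 u, h4 v, h4 w, h1 u v w, h1 u w v, h1 v w u, h2 u v w, h2 v u w, h2 w u v]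

end CubicForms

/-! ### Vanishing of σ and the curvature of totally geodesic submanifolds. -/

section Main

variable {E : Type*} [NormedAddCommGroup E] [NormedSpace ℝ E] [FiniteDimensional ℝ E]
  {M : Type*} [TopologicalSpace M] [ChartedSpace E M] [IsManifold 𝓘(ℝ, E) ∞ M]
  [RiemannianBundle (fun x : M ↦ TangentSpace 𝓘(ℝ, E) x)]
  [IsContMDiffRiemannianBundle 𝓘(ℝ, E) ∞ E (fun x : M ↦ TangentSpace 𝓘(ℝ, E) x)]
  {E' : Type*} [NormedAddCommGroup E'] [NormedSpace ℝ E'] [FiniteDimensional ℝ E']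
  {N : Type*} [TopologicalSpace N] [ChartedSpace E' N] [IsManifold 𝓘(ℝ, E') ∞ N]
  [RiemannianBundle (fun x : N ↦ TangentSpace 𝓘(ℝ, E') x)]
  [IsContMDiffRiemannianBundle 𝓘(ℝ, E') ∞ E' (fun x : N ↦ TangentSpace 𝓘(ℝ, E') x)]
  {J : Π x : N, TangentSpace 𝓘(ℝ, E') x →L[ℝ] TangentSpace 𝓘(ℝ, E') x}
  {F : C^∞⟮𝓘(ℝ, E), M; 𝓘(ℝ, E'), N⟯} {p : M} {X Y Z W : Π q : M, TangentSpace 𝓘(ℝ, E) q}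

/-- A totally real semiparallel submanifold with parallel `f`-structure and constant nonzero
curvature is totally geodesic. -/
theorem sffTensor_eq_zero (hE : 1 < finrank ℝ E) (hJ : IsKaehler J) (hF : IsIsometricImmersion F)
    (hreal : IsTotallyReal J F) (hf : HasParallelNormalF J F) (hsemi : IsSemiparallel F) {c : ℝ}
    (hc : HasConstantCurvature E M c) (hc0 : c ≠ 0) : sffTensor F p = 0 := by
  have h1 (u v w : TangentSpace 𝓘(ℝ, E) p) : cubicForm J F p u v w = cubicForm J F p v u w := by
    rw [cubicForm_apply, cubicForm_apply, sffTensor_comm]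
  have h2 (u v w : TangentSpace 𝓘(ℝ, E) p) : cubicForm J F p u v w = cubicForm J F p u w v :=
    inner_sffTensor_swap hJ hreal u v w
  have h3 := cubic_eq_zero (V := TangentSpace 𝓘(ℝ, E) p) hE h1 h2 fun x y z u t ↦ by
    have h4 := cubicForm_curvatureTensor hJ hF hreal hf hsemi x y z u t
    simp only [hc.curvatureTensor_eq, mul_smul, ← smul_sub, map_smul, LinearMap.smul_apply] at h4
    rw [← smul_add, ← smul_add] at h4
    exact (smul_eq_zero.1 h4).resolve_left hc0
  ext u v
  -- With σ(u,v) = J(dF a), the vanishing value C(u,v,a) equals |σ(u,v)|².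
  obtain ⟨a, ha⟩ := exists_sffTensor_eq hJ hF hreal hf u v
  have h4 := h3 u v a
  rw [cubicForm_apply, ← ha] at h4
  exact inner_self_eq_zero.1 h4

/-- The curvature of a totally geodesic submanifold is the curvature of the ambient manifold. -/
theorem curvatureTensor_differential (hσ : ∀ q, sffTensor F q = 0)
    (u v w : TangentSpace 𝓘(ℝ, E) p) :
    curvatureTensor (F p) (differential F p u) (differential F p v) (differential F p w)
      = differential F p (curvatureTensor p u v w) := by
  have h (v : TangentSpace 𝓘(ℝ, E) p) := contMDiffAt_extend (k := ∞) 𝓘(ℝ, E) E v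
  -- Since σ = 0 at every point, dF intertwines the connections near p, as iterated derivatives
  -- require.
  have h1 {q : M} {W : Π q : M, TangentSpace 𝓘(ℝ, E) q} (hW : MDiffAt (T% W) q)
      (u : TangentSpace 𝓘(ℝ, E) q) :
      covDerivAlong F (fun q ↦ differential F q (W q)) q u = differential F q (leviCivita W q u) := by
    rw [covDerivAlong_differential hW, hσ, LinearMap.zero_apply, LinearMap.zero_apply, add_zero]
  have h2 (u v : TangentSpace 𝓘(ℝ, E) p) : covDerivAlong F (fun q ↦ covDerivAlong F
      (fun q ↦ differential F q (extend E w q)) q (extend E v q)) p u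
      = differential F p (leviCivita (fun q ↦ leviCivita (extend E w) q (extend E v q)) p u) := by
    rw [← h1 ((contMDiffAt_leviCivita (h v) (h w)).mdifferentiableAt (by simp))]
    rw [covDerivAlong_congr]
    filter_upwards [ContMDiffAt.eventually_mdifferentiableAt_section (h w)] with q hq
    exact h1 hq _
  have h3 := curvatureAlong_eq (F := F) (h u) (h v) (SmoothAlongAt.differential (h w))
  have h4 := curvature_eq_curvatureTensor (h u) (h v) (h w)
  simp only [extend_apply_self] at h3 h4
  rw [← h3, ← h4, curvatureAlong, h2, h2, h1 (mdifferentiableAt_extend 𝓘(ℝ, E) E w), curvature,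
    map_sub, map_sub]

end Main

end TotallyReal

end

theorem mainTheorem4
    {n m : ℕ} (hn : 1 < n)
    -- the Riemannian manifold `M` of dimension `n`
    {E : Type*} [NormedAddCommGroup E] [NormedSpace ℝ E] [FiniteDimensional ℝ E]
    (hE : Module.finrank ℝ E = n)
    {M : Type*} [TopologicalSpace M] [ChartedSpace E M] [IsManifold 𝓘(ℝ, E) ∞ M] [Nonempty M]
    [RiemannianBundle (fun x : M ↦ TangentSpace 𝓘(ℝ, E) x)]
    [IsContMDiffRiemannianBundle 𝓘(ℝ, E) ∞ E (fun x : M ↦ TangentSpace 𝓘(ℝ, E) x)]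
    -- the Riemannian manifold `N` of dimension `2m`
    {E' : Type*} [NormedAddCommGroup E'] [NormedSpace ℝ E'] [FiniteDimensional ℝ E']
    (hE' : Module.finrank ℝ E' = 2 * m)
    {N : Type*} [TopologicalSpace N] [ChartedSpace E' N] [IsManifold 𝓘(ℝ, E') ∞ N]
    [RiemannianBundle (fun x : N ↦ TangentSpace 𝓘(ℝ, E') x)]
    [IsContMDiffRiemannianBundle 𝓘(ℝ, E') ∞ E' (fun x : N ↦ TangentSpace 𝓘(ℝ, E') x)]
    (J : Π x : N, TangentSpace 𝓘(ℝ, E') x →L[ℝ] TangentSpace 𝓘(ℝ, E') x) (μ : ℝ)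
    (hN : TotallyReal.IsComplexSpaceForm J μ)
    (F : C^∞⟮𝓘(ℝ, E), M; 𝓘(ℝ, E'), N⟯) (hF : TotallyReal.IsIsometricImmersion F)
    (hreal : TotallyReal.IsTotallyReal J F)
    (hsemi : TotallyReal.IsSemiparallel F)
    (c : ℝ) (hc : TotallyReal.HasConstantCurvature E M c)
    (hf : TotallyReal.HasParallelNormalF J F) :
    (c = 0 ∧ TotallyReal.IsFlat E M) ∨ (TotallyReal.IsTotallyGeodesic F ∧ c = μ / 4) := by
  have hJ := hN.isKaehler
  have hn' : 1 < Module.finrank ℝ E := by rwa [hE]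
  by_cases hc0 : c = 0
  · refine .inl ⟨hc0, fun p X Y Z hX hY hZ ↦ ?_⟩
    rw [TotallyReal.curvature_eq_curvatureTensor hX hY hZ, hc.curvatureTensor_eq, hc0]
    simp
  have hσ (p : M) : TotallyReal.sffTensor F p = 0 :=
    TotallyReal.sffTensor_eq_zero hn' hJ hF hreal hf hsemi hc hc0
  refine .inr ⟨fun p X Y hX hY ↦ ?_, ?_⟩
  · rw [TotallyReal.secondFundamentalForm_eq (hY.mdifferentiableAt (by simp)), hσ]
    rfl
  · obtain ⟨p⟩ := ‹Nonempty M›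
    have : Nontrivial (TangentSpace 𝓘(ℝ, E) p) :=
      Module.nontrivial_of_finrank_pos (R := ℝ) (M := E) (by lia)
    obtain ⟨x, hx⟩ := exists_ne (0 : TangentSpace 𝓘(ℝ, E) p)
    -- An orthogonal pair exists as n > 1. Its image spans a totally real plane, whose curvature is
    -- c by σ = 0 and μ/4 in the space form.
    obtain ⟨y, hy, hxy⟩ := TotallyReal.exists_ne_zero_inner_eq_zero
      (V := TangentSpace 𝓘(ℝ, E) p) hn' x
    have h1 := (TotallyReal.isCurvatureLike_curvatureTensor (F p)).totallyReal_sectional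
      (V := TangentSpace 𝓘(ℝ, E') (F p)) (hJ.sq (F p)) (hJ.isometry (F p))
      hJ.curvatureTensor_comm hN.inner_curvatureTensor
      (u := TotallyReal.differential F p x) (v := TotallyReal.differential F p y)
      (by rw [hF, hxy]) (hreal.inner_eq_zero x y)
    rw [TotallyReal.curvatureTensor_differential hσ, hF, hF, hF, hc.curvatureTensor_eq, hxy,
      mul_zero, zero_smul, sub_zero, real_inner_smul_left] at h1
    have hx0 : inner ℝ x x ≠ 0 := inner_self_ne_zero.2 hx
    have hy0 : inner ℝ y y ≠ 0 := inner_self_ne_zero.2 hy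
    refine mul_right_cancel₀ (mul_ne_zero hx0 hy0) ?_
    linarith
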